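/- Let $\Sigma^n\subset\mathbb{R}^{n+1}$ be a smooth embedded hypersurface without boundary, with unit normal field $\mathbf{n}$. Let $\nabla$ be the induced connection, $\Delta$ the Laplacian on functions and tensor fields on $\Sigma$, $x$ the position vector, $x^T$ its tangential part, $H=\operatorname{div}_\Sigma\mathbf{n}$ the mean curvature, and $A$ the second fundamental form, with coefficients $a_{ij}=\langle\nabla_{e_i}e_j,\mathbf{n}\rangle$ (the derivative being that of $\mathbb{R}^{n+1}$) in a local orthonormal frame $e_i$ of $\Sigma$; so $H=-\sum_i a_{ii}$. Put $|A|^2=\sum_{i,j}a_{ij}^2$, $(A^2)_{ij}=\sum_k a_{ik}a_{kj}$, $\langle A^2,A\rangle=\sum_{i,j}(A^2)_{ij}a_{ij}$, $|\nabla A|^2=\sum_{i,j,k}\big((\nabla_{e_k}A)(e_i,e_j)\big)^2$ and, on functions and tensor fields, $$\mathcal{L}=\Delta-\tfrac12\nabla_{x^T},\qquad L=\Delta-\tfrac12\nabla_{x^T}+|A|^2+\tfrac12 .$$ If $\Sigma$ is a $\lambda$-hypersurface, that is, $H-\tfrac12\langle x,\mathbf{n}\rangle=\lambda$ on $\Sigma$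 for a constant $\lambda\in\mathbb{R}$, then on all of $\Sigma$ $$LA=A-\lambda A^2,$$ $$LH=H+\lambda|A|^2,$$ $$\mathcal{L}|A|^2=2\Big(\tfrac12-|A|^2\Big)|A|^2-2\lambda\langle A^2,A\rangle+2|\nabla A|^2 .$$ -/

import Mathlib

open scoped ContDiff InnerProductSpace

noncomputable section

namespace LambdaHypersurface

/-- The ambient Euclidean space `ℝⁿ⁺¹`. -/
abbrev Amb (n : ℕ) : Type := EuclideanSpace ℝ (Fin (n + 1))

/-- `S ⊆ ℝⁿ⁺¹` is a smooth embedded hypersurface without boundary: near each of its points it is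
the zero set of a smooth real function with nowhere vanishing differential. -/
def IsSmoothHypersurface {n : ℕ} (S : Set (Amb n)) : Prop :=
  ∀ p ∈ S, ∃ U : Set (Amb n), IsOpen U ∧ p ∈ U ∧ ∃ f : Amb n → ℝ,
    ContDiffOn ℝ ∞ f U ∧ (∀ q ∈ U, fderiv ℝ f q ≠ 0) ∧ S ∩ U = {q ∈ U | f q = 0}

/-- The tangent space `T_p S`, as a linear subspace of `ℝⁿ⁺¹`. (For a hypersurface the tangent cone
is already a linear subspace.) -/
def tangent {n : ℕ} (S : Set (Amb n)) (p : Amb n) : Submodule ℝ (Amb n) :=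
  Submodule.span ℝ (tangentConeAt ℝ S p)

/-- The orthogonal projection `v ↦ vᵀ` of `ℝⁿ⁺¹` onto `T_p S`. -/
def proj {n : ℕ} (S : Set (Amb n)) (p : Amb n) : Amb n →L[ℝ] Amb n :=
  (tangent S p).starProjection

/-- An orthonormal basis of `T_p S`. -/
def frame {n : ℕ} (S : Set (Amb n)) (p : Amb n) :
    OrthonormalBasis (Fin (Module.finrank ℝ (tangent S p))) ℝ (tangent S p) :=
  stdOrthonormalBasis ℝ (tangent S p)

/-- `N` is a (continuous) unit normal field along `S`. On a smooth hypersurface it is then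
automatically smooth. Only the values of `N` on `S` matter. -/
structure IsUnitNormal {n : ℕ} (S : Set (Amb n)) (N : Amb n → Amb n) : Prop where
  continuousOn : ContinuousOn N S
  norm_eq_one : ∀ p ∈ S, ‖N p‖ = 1
  orthogonal : ∀ p ∈ S, ∀ v ∈ tangent S p, ⟪v, N p⟫_ℝ = 0

/-- The derivative `D_w F` at `p` of a vector valued map `F` along `S`, in the tangent
direction `w ∈ T_p S` (it is determined by the restriction of `F` to `S`, see
`dirDeriv_eq_of_hasFDerivWithinAt`). -/
def dirDeriv {n : ℕ} (S : Set (Amb n)) {G : Type*} [NormedAddCommGroup G] [NormedSpace ℝ G]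
    (F : Amb n → G) (p w : Amb n) : G :=
  fderivWithin ℝ F S p w

theorem dirDeriv_eq_of_hasFDerivWithinAt {n : ℕ} {S : Set (Amb n)} {G : Type*}
    [NormedAddCommGroup G] [NormedSpace ℝ G] {F : Amb n → G} {F' : Amb n →L[ℝ] G} {p w : Amb n}
    (hF : HasFDerivWithinAt F F' S p) (hw : w ∈ tangent S p) : dirDeriv S F p w = F' w := by
  have h : Set.EqOn (fderivWithin ℝ F S p) F' (tangentConeAt ℝ S p) :=
    hF.differentiableWithinAt.hasFDerivWithinAt.unique_on hF
  have h2 : Set.EqOn (fderivWithin ℝ F S p : Amb n →ₗ[ℝ] G) (F' : Amb n →ₗ[ℝ] G)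
      (Submodule.span ℝ (tangentConeAt ℝ S p)) := LinearMap.eqOn_span h
  exact h2 hw

/-- The extension `q ↦ (v)ᵀ ∈ T_q S` of a vector `v` to a tangent vector field along `S`. -/
def ext {n : ℕ} (S : Set (Amb n)) (v : Amb n) : Amb n → Amb n := fun q => proj S q v

/-- The induced (Levi-Civita) connection `∇_w V = (D_w V)ᵀ` on tangent vector fields. -/
def nablaVec {n : ℕ} (S : Set (Amb n)) (V : Amb n → Amb n) (p w : Amb n) : Amb n :=
  proj S p (dirDeriv S V p w)

/-- The extension of a tangent vector by `ext` is parallel at the base point. -/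
theorem nablaVec_ext {n : ℕ} {S : Set (Amb n)} {p v w : Amb n}
    (hd : DifferentiableWithinAt ℝ (proj S) S p)
    (hv : v ∈ tangent S p) (hw : w ∈ tangent S p) : nablaVec S (ext S v) p w = 0 := by
  have hP := hd.hasFDerivWithinAt
  have hPv : proj S p v = v := Submodule.starProjection_eq_self_iff.2 hv
  have h1 : HasFDerivWithinAt (ext S v) _ S p := hP.clm_apply (hasFDerivWithinAt_const v p S)
  have h2 : HasFDerivWithinAt (fun q => proj S q (ext S v q)) _ S p := hP.clm_apply h1
  have h3 : (fun q => proj S q (ext S v q)) = ext S v := by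
    funext q
    exact Submodule.starProjection_eq_self_iff.2 (Submodule.starProjection_apply_mem _ _)
  rw [h3] at h2
  have e1 := dirDeriv_eq_of_hasFDerivWithinAt h1 hw
  have e2 := dirDeriv_eq_of_hasFDerivWithinAt h2 hw
  have e3 := e1.symm.trans e2
  simp [ext, hPv] at e3
  rw [nablaVec, e1]
  simpa using e3

/-- A covariant `k`-tensor field along `S`: at `p ∈ S` it is evaluated at `k` vectors of `T_p S`. -/
abbrev Tensor (n k : ℕ) : Type := Amb n → (Fin k → Amb n) → ℝ

/-- A function as a tensor field of rank `0`. -/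
def scalar {n : ℕ} (f : Amb n → ℝ) : Tensor n 0 := fun p _ => f p

/-- The covariant derivative of a tensor field,
`(∇T)(w, v₁, …, v_k) = w(T(V₁, …, V_k)) - ∑ᵢ T(V₁, …, ∇_w Vᵢ, …, V_k)`
with `Vᵢ = ext S vᵢ`; as these extensions are parallel at `p` (`nablaVec_ext`), the terms of the
sum are zero and are left out. The direction of differentiation is the first argument. -/
def nabla {n k : ℕ} (S : Set (Amb n)) (T : Tensor n k) : Tensor n (k + 1) := fun p v =>
  dirDeriv S (fun q => T q (fun i => ext S (v i.succ) q)) p (v 0)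

/-- The inner product of two tensors at `p`, in an orthonormal basis of `T_p S`. -/
def tensorInner {n k : ℕ} (S : Set (Amb n)) (T T' : Tensor n k) (p : Amb n) : ℝ :=
  ∑ c : Fin k → Fin (Module.finrank ℝ (tangent S p)),
    T p (fun i => (frame S p (c i) : Amb n)) * T' p (fun i => (frame S p (c i) : Amb n))

/-- The Laplacian `ΔT = ∑ᵢ ∇²T(eᵢ, eᵢ, ·)` of a tensor field (of a function, if `k = 0`). -/
def laplacian {n k : ℕ} (S : Set (Amb n)) (T : Tensor n k) : Tensor n k := fun p v =>
  ∑ i, nabla S (nabla S T) p (Fin.cons (frame S p i : Amb n) (Fin.cons (frame S p i : Amb n) v))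

/-- `⟨x, ∇T⟩ = ∇_{xᵀ} T`, where `x` is the position vector. -/
def nablaPos {n k : ℕ} (S : Set (Amb n)) (T : Tensor n k) : Tensor n k := fun p v =>
  nabla S T p (Fin.cons (proj S p p) v)

/-- The mean curvature `H = div_S N = ∑ᵢ ⟨D_{eᵢ} N, eᵢ⟩`. -/
def meanCurv {n : ℕ} (S : Set (Amb n)) (N : Amb n → Amb n) (p : Amb n) : ℝ :=
  ∑ i, ⟪dirDeriv S N p (frame S p i), (frame S p i : Amb n)⟫_ℝ

/-- The second fundamental form `A(u, v) = ⟨D_u V, N⟩`, `V` a tangent field extending `v`. -/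
def sff {n : ℕ} (S : Set (Amb n)) (N : Amb n → Amb n) : Tensor n 2 := fun p v =>
  ⟪dirDeriv S (ext S (v 1)) p (v 0), N p⟫_ℝ

/-- `A²(u, v) = ∑ₖ A(u, eₖ) A(eₖ, v)`. -/
def sffSq {n : ℕ} (S : Set (Amb n)) (N : Amb n → Amb n) : Tensor n 2 := fun p v =>
  ∑ k, sff S N p ![v 0, (frame S p k : Amb n)] * sff S N p ![(frame S p k : Amb n), v 1]

/-- `|A|²`. -/
def sffNormSq {n : ℕ} (S : Set (Amb n)) (N : Amb n → Amb n) (p : Amb n) : ℝ :=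
  tensorInner S (sff S N) (sff S N) p

/-- The drift Laplacian `𝓛 = Δ - ½⟨x, ∇ ·⟩`. -/
def driftLap {n k : ℕ} (S : Set (Amb n)) (T : Tensor n k) : Tensor n k := fun p v =>
  laplacian S T p v - (1 / 2 : ℝ) * nablaPos S T p v

/-- The operator `L = Δ - ½⟨x, ∇ ·⟩ + |A|² + ½`. -/
def stabOp {n k : ℕ} (S : Set (Amb n)) (N : Amb n → Amb n) (T : Tensor n k) : Tensor n k :=
  fun p v => laplacian S T p v - (1 / 2 : ℝ) * nablaPos S T p v + sffNormSq S N p * T p v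
    + (1 / 2 : ℝ) * T p v

/-- `S`, with unit normal `N`, is a `lam`-hypersurface: `H - ⟨x, N⟩ / 2 = lam`. -/
structure IsLambdaHypersurface {n : ℕ} (lam : ℝ) (S : Set (Amb n)) (N : Amb n → Amb n) :
    Prop where
  smooth : IsSmoothHypersurface S
  normal : IsUnitNormal S N
  eqn : ∀ p ∈ S, meanCurv S N p - ⟪p, N p⟫_ℝ / 2 = lam

end LambdaHypersurface

end

/-! Let W be the derivative of N along S, extended by zero to the normal direction (`shape`). It is
a self-adjoint endomorphism of the ambient space with W N = 0, and A(u, v) = -⟨W u, v⟩ on tangent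
vectors. Since W takes values in a fixed space, it can be differentiated along S in constant ambient
directions and traced over a fixed ambient basis, so no moving frame is needed. The price is a set
of normal components, all found by differentiating |N|² = 1, W N = 0 and their consequences.

Second derivatives of W in two tangent directions commute at the base point, because the ambient
space is flat. The cubic terms of Simons' identity come instead from differentiating the normal
terms of the Codazzi equation (`ddShape_sub`). Two such swaps and one commutation turn ΔW into Hess
H plus cubic terms (`sum_inner_ddShape`), whence ΔA = -Hess H - H A² - |A|² A (`laplacian_sff`).

The λ-equation enters through H = λ + ½⟨x, N⟩ and its second derivative: Hess H = -½A - ½∇_{xᵀ}A -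
½⟨x, N⟩A² (`IsLambdaHypersurface.tgrad_tgrad_meanCurv`). Substitution gives the first identity,
since H - ½⟨x, N⟩ = λ; tracing Hess H gives the second. The third is the product rule Δ|A|² = 2⟨ΔA,
A⟩ + 2|∇A|², carried out with W in place of A; the extra normal terms cancel. -/

namespace LambdaHypersurface

variable {n : ℕ} {S : Set (Amb n)}

/-! ### Differential calculus along a subset of Euclidean space. -/

section Calculus

variable {G G₁ G₂ : Type*} [NormedAddCommGroup G] [NormedSpace ℝ G]
  [NormedAddCommGroup G₁] [NormedSpace ℝ G₁] [NormedAddCommGroup G₂] [NormedSpace ℝ G₂]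

/-- `F` is smooth along `S`: near each point of `S` it agrees on `S` with a smooth map defined on
an open subset of the ambient space. -/
def SmoothOn (S : Set (Amb n)) (F : Amb n → G) : Prop :=
  ∀ p ∈ S, ∃ U : Set (Amb n), IsOpen U ∧ p ∈ U ∧ ∃ F' : Amb n → G,
    ContDiffOn ℝ ∞ F' U ∧ Set.EqOn F F' (S ∩ U)

/-- The derivative along `S`, extended by zero to normal directions. -/
noncomputable def tgrad (S : Set (Amb n)) (F : Amb n → G) (p : Amb n) : Amb n →L[ℝ] G :=
  (fderivWithin ℝ F S p).comp (proj S p)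

theorem proj_mem (p v : Amb n) : proj S p v ∈ tangent S p :=
  Submodule.starProjection_apply_mem _ _

theorem proj_eq_self {p v : Amb n} (hv : v ∈ tangent S p) : proj S p v = v :=
  Submodule.starProjection_eq_self_iff.2 hv

theorem proj_proj (p v : Amb n) : proj S p (proj S p v) = proj S p v :=
  proj_eq_self (proj_mem p v)

theorem tgrad_proj (F : Amb n → G) (p v : Amb n) :
    tgrad S F p (proj S p v) = tgrad S F p v := by
  simp [tgrad, proj_proj]

theorem dirDeriv_eq_tgrad (F : Amb n → G) {p v : Amb n} (hv : v ∈ tangent S p) :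
    dirDeriv S F p v = tgrad S F p v := by
  simp [tgrad, dirDeriv, proj_eq_self hv]

theorem tgrad_eq {F : Amb n → G} {F' : Amb n →L[ℝ] G} {p : Amb n}
    (hF : HasFDerivWithinAt F F' S p) (w : Amb n) : tgrad S F p w = F' (proj S p w) :=
  dirDeriv_eq_of_hasFDerivWithinAt hF (proj_mem p w)

theorem tgrad_congr {F F' : Amb n → G} {p : Amb n} (hp : p ∈ S) (h : Set.EqOn F F' S) :
    tgrad S F p = tgrad S F' p := by
  rw [tgrad, tgrad, fderivWithin_congr h (h hp)]

theorem dirDeriv_congr {F F' : Amb n → G} {p : Amb n} (hp : p ∈ S) (h : Set.EqOn F F' S)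
    (w : Amb n) : dirDeriv S F p w = dirDeriv S F' p w := by
  rw [dirDeriv, dirDeriv, fderivWithin_congr h (h hp)]

theorem SmoothOn.differentiableWithinAt {F : Amb n → G} (hF : SmoothOn S F) {p : Amb n}
    (hp : p ∈ S) : DifferentiableWithinAt ℝ F S p := by
  obtain ⟨U, hU, hpU, F', hF', he⟩ := hF p hp
  have h1 : DifferentiableWithinAt ℝ F' S p :=
    ((hF'.contDiffAt (hU.mem_nhds hpU)).differentiableAt (by simp)).differentiableWithinAt
  refine h1.congr_of_eventuallyEq ?_ (he ⟨hp, hpU⟩)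
  filter_upwards [self_mem_nhdsWithin, mem_nhdsWithin_of_mem_nhds (hU.mem_nhds hpU)] with q h1 h2
  exact he ⟨h1, h2⟩

theorem SmoothOn.congr {F F' : Amb n → G} (hF : SmoothOn S F) (h : Set.EqOn F' F S) :
    SmoothOn S F' := by
  intro p hp
  obtain ⟨U, hU, hpU, Φ, hΦ, he⟩ := hF p hp
  exact ⟨U, hU, hpU, Φ, hΦ, fun q hq => (h hq.1).trans (he hq)⟩

theorem smoothOn_of_contDiff {F : Amb n → G} (hF : ContDiff ℝ ∞ F) : SmoothOn S F :=
  fun _ _ => ⟨Set.univ, isOpen_univ, trivial, F, hF.contDiffOn, fun _ _ => rfl⟩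

theorem smoothOn_const (c : G) : SmoothOn S (fun _ : Amb n => c) :=
  smoothOn_of_contDiff contDiff_const

theorem SmoothOn.comp {Φ : G₁ → G₂} (hΦ : ContDiff ℝ ∞ Φ) {F : Amb n → G₁}
    (hF : SmoothOn S F) : SmoothOn S (fun q => Φ (F q)) := by
  intro p hp
  obtain ⟨U, hU, hpU, F', hF', he⟩ := hF p hp
  exact ⟨U, hU, hpU, fun q => Φ (F' q), hΦ.comp_contDiffOn hF', fun q hq => by simp [he hq]⟩

theorem SmoothOn.prodMk {F : Amb n → G₁} {F₂ : Amb n → G₂}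
    (hF : SmoothOn S F) (hF₂ : SmoothOn S F₂) : SmoothOn S (fun q => (F q, F₂ q)) := by
  intro p hp
  obtain ⟨U, hU, hpU, F', hF', he⟩ := hF p hp
  obtain ⟨U₂, hU₂, hpU₂, F₂', hF₂', he₂⟩ := hF₂ p hp
  refine ⟨U ∩ U₂, hU.inter hU₂, ⟨hpU, hpU₂⟩, fun q => (F' q, F₂' q),
    (hF'.mono Set.inter_subset_left).prodMk (hF₂'.mono Set.inter_subset_right), fun q hq => ?_⟩
  simp [he ⟨hq.1, hq.2.1⟩, he₂ ⟨hq.1, hq.2.2⟩]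

theorem SmoothOn.clm_apply {M : Amb n → G₁ →L[ℝ] G₂} {V : Amb n → G₁}
    (hM : SmoothOn S M) (hV : SmoothOn S V) : SmoothOn S (fun q => M q (V q)) :=
  SmoothOn.comp (Φ := fun x : (G₁ →L[ℝ] G₂) × G₁ => x.1 x.2)
    (contDiff_fst.clm_apply contDiff_snd) (hM.prodMk hV)

theorem SmoothOn.inner {V V' : Amb n → Amb n} (hV : SmoothOn S V) (hV' : SmoothOn S V') :
    SmoothOn S (fun q => ⟪V q, V' q⟫_ℝ) :=
  SmoothOn.comp (Φ := fun x : Amb n × Amb n => ⟪x.1, x.2⟫_ℝ)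
    (contDiff_fst.inner ℝ contDiff_snd) (hV.prodMk hV')

theorem SmoothOn.smul {c : Amb n → ℝ} {V : Amb n → G} (hc : SmoothOn S c) (hV : SmoothOn S V) :
    SmoothOn S (fun q => c q • V q) :=
  SmoothOn.comp (Φ := fun x : ℝ × G => x.1 • x.2)
    (contDiff_fst.smul contDiff_snd) (hc.prodMk hV)

theorem SmoothOn.mul {c d : Amb n → ℝ} (hc : SmoothOn S c) (hd : SmoothOn S d) :
    SmoothOn S (fun q => c q * d q) :=
  hc.smul hd

theorem SmoothOn.add {V V' : Amb n → G} (hV : SmoothOn S V) (hV' : SmoothOn S V') :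
    SmoothOn S (fun q => V q + V' q) :=
  SmoothOn.comp (Φ := fun x : G × G => x.1 + x.2)
    (contDiff_fst.add contDiff_snd) (hV.prodMk hV')

theorem SmoothOn.neg {V : Amb n → G} (hV : SmoothOn S V) : SmoothOn S (fun q => -V q) :=
  SmoothOn.comp (Φ := fun x : G => -x) contDiff_neg hV

theorem SmoothOn.sub {V V' : Amb n → G} (hV : SmoothOn S V) (hV' : SmoothOn S V') :
    SmoothOn S (fun q => V q - V' q) := by
  simpa only [sub_eq_add_neg] using hV.add hV'.neg

/-- Makes iterated derivatives available. `fderivWithin` is determined only on tangent vectors;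
after composition with the projection it agrees on S with the derivative of any smooth local
extension, which is again smooth. -/
theorem SmoothOn.tgrad {F : Amb n → G} (hF : SmoothOn S F) (hP : SmoothOn S (proj S)) :
    SmoothOn S (tgrad S F) := by
  have h : SmoothOn S (fun q => fderivWithin ℝ F S q ∘L proj S q) := by
    intro p hp
    obtain ⟨U, hU, hpU, F', hF', he⟩ := hF p hp
    obtain ⟨U₂, hU₂, hpU₂, P', hP', he₂⟩ := hP p hp
    refine ⟨U ∩ U₂, hU.inter hU₂, ⟨hpU, hpU₂⟩, fun q => fderiv ℝ F' q ∘L P' q,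
      ((hF'.fderiv_of_isOpen hU (by simp)).mono Set.inter_subset_left).clm_comp
        (hP'.mono Set.inter_subset_right), fun q hq => ?_⟩
    have hd : HasFDerivWithinAt F (fderiv ℝ F' q) S q := by
      refine (((hF'.contDiffAt (hU.mem_nhds hq.2.1)).differentiableAt
        (by simp)).hasFDerivAt.hasFDerivWithinAt).congr_of_eventuallyEq ?_ (he ⟨hq.1, hq.2.1⟩)
      filter_upwards [self_mem_nhdsWithin,
        mem_nhdsWithin_of_mem_nhds (hU.mem_nhds hq.2.1)] with r h1 h2
      exact he ⟨h1, h2⟩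
    ext1 w
    have e : proj S q = P' q := he₂ ⟨hq.1, hq.2.2⟩
    simpa [LambdaHypersurface.tgrad, e] using tgrad_eq hd w
  exact h

theorem tgrad_const (c : G) (p w : Amb n) : tgrad S (fun _ => c) p w = 0 := by
  rw [tgrad_eq (hasFDerivWithinAt_const c p S)]; simp

theorem tgrad_id (p w : Amb n) : tgrad S (fun q => q) p w = proj S p w :=
  tgrad_eq (hasFDerivWithinAt_id p S) w

variable {p : Amb n}

theorem tgrad_clm_apply {M : Amb n → G₁ →L[ℝ] G₂} {V : Amb n → G₁}
    (hM : DifferentiableWithinAt ℝ M S p) (hV : DifferentiableWithinAt ℝ V S p) (w : Amb n) :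
    tgrad S (fun q => M q (V q)) p w = tgrad S M p w (V p) + M p (tgrad S V p w) := by
  rw [tgrad_eq (hM.hasFDerivWithinAt.clm_apply hV.hasFDerivWithinAt)]
  simp [tgrad, add_comm]

theorem tgrad_apply_const {M : Amb n → G₁ →L[ℝ] G₂} (hM : DifferentiableWithinAt ℝ M S p)
    (v : G₁) (w : Amb n) : tgrad S (fun q => M q v) p w = tgrad S M p w v := by
  rw [tgrad_clm_apply hM (differentiableWithinAt_const v), tgrad_const]; simp

theorem tgrad_inner {V V' : Amb n → Amb n} (hV : DifferentiableWithinAt ℝ V S p)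
    (hV' : DifferentiableWithinAt ℝ V' S p) (w : Amb n) :
    tgrad S (fun q => ⟪V q, V' q⟫_ℝ) p w = ⟪tgrad S V p w, V' p⟫_ℝ + ⟪V p, tgrad S V' p w⟫_ℝ := by
  rw [tgrad_eq (hV.hasFDerivWithinAt.inner ℝ hV'.hasFDerivWithinAt)]
  simp [tgrad, add_comm]

theorem tgrad_inner_const {V : Amb n → Amb n} (hV : DifferentiableWithinAt ℝ V S p)
    (v w : Amb n) : tgrad S (fun q => ⟪V q, v⟫_ℝ) p w = ⟪tgrad S V p w, v⟫_ℝ := by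
  rw [tgrad_inner hV (differentiableWithinAt_const v), tgrad_const]; simp

theorem tgrad_const_inner {V : Amb n → Amb n} (hV : DifferentiableWithinAt ℝ V S p)
    (v w : Amb n) : tgrad S (fun q => ⟪v, V q⟫_ℝ) p w = ⟪v, tgrad S V p w⟫_ℝ := by
  rw [tgrad_inner (differentiableWithinAt_const v) hV, tgrad_const]; simp

theorem tgrad_smul {c : Amb n → ℝ} {V : Amb n → G} (hc : DifferentiableWithinAt ℝ c S p)
    (hV : DifferentiableWithinAt ℝ V S p) (w : Amb n) :
    tgrad S (fun q => c q • V q) p w = tgrad S c p w • V p + c p • tgrad S V p w := by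
  rw [tgrad_eq (hc.hasFDerivWithinAt.fun_smul hV.hasFDerivWithinAt)]
  simp [tgrad, add_comm]

theorem tgrad_mul {c d : Amb n → ℝ} (hc : DifferentiableWithinAt ℝ c S p)
    (hd : DifferentiableWithinAt ℝ d S p) (w : Amb n) :
    tgrad S (fun q => c q * d q) p w = tgrad S c p w * d p + c p * tgrad S d p w :=
  tgrad_smul hc hd w

theorem tgrad_add {V V' : Amb n → G} (hV : DifferentiableWithinAt ℝ V S p)
    (hV' : DifferentiableWithinAt ℝ V' S p) (w : Amb n) :
    tgrad S (fun q => V q + V' q) p w = tgrad S V p w + tgrad S V' p w := by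
  rw [tgrad_eq (hV.hasFDerivWithinAt.fun_add hV'.hasFDerivWithinAt)]
  simp [tgrad]

theorem tgrad_sub {V V' : Amb n → G} (hV : DifferentiableWithinAt ℝ V S p)
    (hV' : DifferentiableWithinAt ℝ V' S p) (w : Amb n) :
    tgrad S (fun q => V q - V' q) p w = tgrad S V p w - tgrad S V' p w := by
  rw [tgrad_eq (hV.hasFDerivWithinAt.fun_sub hV'.hasFDerivWithinAt)]
  simp [tgrad]

theorem tgrad_neg {V : Amb n → G} (hV : DifferentiableWithinAt ℝ V S p) (w : Amb n) :
    tgrad S (fun q => -V q) p w = -tgrad S V p w := by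
  rw [tgrad_eq hV.hasFDerivWithinAt.fun_neg]
  simp [tgrad]

theorem tgrad_sum {ι : Type*} {s : Finset ι} {V : ι → Amb n → G}
    (hV : ∀ i ∈ s, DifferentiableWithinAt ℝ (V i) S p) (w : Amb n) :
    tgrad S (fun q => ∑ i ∈ s, V i q) p w = ∑ i ∈ s, tgrad S (V i) p w := by
  rw [tgrad_eq (HasFDerivWithinAt.fun_sum fun i hi => (hV i hi).hasFDerivWithinAt)]
  simp [tgrad]

end Calculus

end LambdaHypersurface

/-! ### Tangent spaces, and regularity of the unit normal. -/

namespace LambdaHypersurface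

variable {n : ℕ} {S : Set (Amb n)}

section Geometry

open Filter Topology

/-- One inclusion: f vanishes on S near p, so 0 and Df are both derivatives of f within S and agree
on the tangent cone. The other: the implicit function maps a neighbourhood of 0 in ker Df into S,
and its derivative at 0 is the inclusion. -/
theorem tangent_eq_ker {p : Amb n} {U : Set (Amb n)} {f : Amb n → ℝ} (hp : p ∈ S) (hU : IsOpen U)
    (hpU : p ∈ U) (hf : ContDiffOn ℝ ∞ f U) (hf' : fderiv ℝ f p ≠ 0)
    (hSU : S ∩ U = {q ∈ U | f q = 0}) : tangent S p = (fderiv ℝ f p).ker := by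
  have hU' : U ∈ 𝓝 p := hU.mem_nhds hpU
  have hcd := hf.contDiffAt hU'
  have hs : HasStrictFDerivAt f (fderiv ℝ f p) p := hcd.hasStrictFDerivAt (by simp)
  have hfp : f p = 0 := (hSU ▸ ⟨hp, hpU⟩ : p ∈ {q ∈ U | f q = 0}).2
  apply le_antisymm
  · refine Submodule.span_le.2 fun v hv => ?_
    have h0 : HasFDerivWithinAt f (0 : Amb n →L[ℝ] ℝ) S p := by
      refine (hasFDerivWithinAt_const (0 : ℝ) p S).congr_of_eventuallyEq ?_ hfp
      filter_upwards [self_mem_nhdsWithin, mem_nhdsWithin_of_mem_nhds hU'] with q h1 h2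
      exact (hSU ▸ ⟨h1, h2⟩ : q ∈ {q ∈ U | f q = 0}).2
    exact hs.hasFDerivAt.hasFDerivWithinAt.unique_on h0 hv
  · intro v hv
    have hr : (fderiv ℝ f p).range = ⊤ := by
      apply LinearMap.range_eq_top.2
      apply LinearMap.surjective
      intro h
      exact hf' (ContinuousLinearMap.ext fun x => congrArg (fun g : Amb n →ₗ[ℝ] ℝ => g x) h)
    set φ := hs.implicitFunction f (fderiv ℝ f p) hr (f p) with hφ
    have hφ0 : φ 0 = p := hs.implicitFunction_apply_image hr
    have hφd : HasStrictFDerivAt φ (fderiv ℝ f p).ker.subtypeL 0 := hs.to_implicitFunction hr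
    have hφS : ∀ᶠ y in 𝓝 (0 : (fderiv ℝ f p).ker), φ y ∈ S := by
      have h1 : ∀ᶠ y in 𝓝 (0 : (fderiv ℝ f p).ker), f (φ y) = f p := by
        have := hs.map_implicitFunction_eq hr
        exact (Continuous.prodMk_right (f p)).continuousAt.eventually this
      have h2 : ∀ᶠ y in 𝓝 (0 : (fderiv ℝ f p).ker), φ y ∈ U :=
        hφd.hasFDerivAt.continuousAt.eventually (by rw [hφ0]; exact hU')
      filter_upwards [h1, h2] with y h1 h2
      have : φ y ∈ S ∩ U := by rw [hSU]; exact ⟨h2, h1.trans hfp⟩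
      exact this.1
    have h3 := hφd.hasFDerivAt.hasFDerivWithinAt.mapsTo_tangent_cone (s := {y | φ y ∈ S})
    have hv' : (⟨v, hv⟩ : (fderiv ℝ f p).ker) ∈ tangentConeAt ℝ {y | φ y ∈ S} 0 := by
      rw [tangentConeAt_of_mem_nhds hφS]; trivial
    replace h3 := h3 hv'
    rw [hφ0] at h3
    refine Submodule.subset_span (tangentConeAt_mono ?_ h3)
    rintro _ ⟨y, hy, rfl⟩
    exact hy

/-- The gradient of a real function on the ambient space. -/
noncomputable def ambGrad (f : Amb n → ℝ) (q : Amb n) : Amb n :=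
  (InnerProductSpace.toDual ℝ (Amb n)).symm (fderiv ℝ f q)

theorem inner_ambGrad (f : Amb n → ℝ) (q v : Amb n) : ⟪ambGrad f q, v⟫_ℝ = fderiv ℝ f q v := by
  simp [ambGrad]

theorem ambGrad_ne_zero {f : Amb n → ℝ} {q : Amb n} (h : fderiv ℝ f q ≠ 0) :
    ambGrad f q ≠ 0 := by
  simpa [ambGrad] using h

theorem contDiffOn_ambGrad {f : Amb n → ℝ} {U : Set (Amb n)} (hU : IsOpen U)
    (hf : ContDiffOn ℝ ∞ f U) : ContDiffOn ℝ ∞ (ambGrad f) U :=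
  (InnerProductSpace.toDual ℝ (Amb n)).symm.contDiff.comp_contDiffOn
    (hf.fderiv_of_isOpen hU (by simp))

/-- On a hypersurface, a unit normal field is locally `c ∇f` for a smooth function `c`. -/
theorem IsUnitNormal.exists_eq_smul_ambGrad {N : Amb n → Amb n} (hN : IsUnitNormal S N)
    {p : Amb n} {U : Set (Amb n)} {f : Amb n → ℝ} (hp : p ∈ S) (hU : IsOpen U)
    (hpU : p ∈ U) (hf : ContDiffOn ℝ ∞ f U) (hf' : ∀ q ∈ U, fderiv ℝ f q ≠ 0)
    (hSU : S ∩ U = {q ∈ U | f q = 0}) :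
    ∃ V ⊆ U, IsOpen V ∧ p ∈ V ∧ ∃ c : Amb n → ℝ, ContDiffOn ℝ ∞ c V ∧
      Set.EqOn N (fun q => c q • ambGrad f q) (S ∩ V) := by
  have hg := contDiffOn_ambGrad hU hf
  have hg0 : ∀ q ∈ U, ‖ambGrad f q‖ ≠ 0 := fun q hq =>
    norm_ne_zero_iff.2 (ambGrad_ne_zero (hf' q hq))
  have hnorm : ContDiffOn ℝ ∞ (fun q => ‖ambGrad f q‖) U :=
    hg.norm ℝ fun q hq => ambGrad_ne_zero (hf' q hq)
  set σ : Amb n → ℝ := fun q => ⟪N q, ambGrad f q⟫_ℝ with hσ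
  have key : ∀ q ∈ S ∩ U, ambGrad f q = σ q • N q ∧ |σ q| = ‖ambGrad f q‖ := by
    intro q hq
    have hker := tangent_eq_ker hq.1 hU hq.2 hf (hf' q hq.2) hSU
    -- The part w of N orthogonal to ∇f lies in ker Df, so it is tangent and hence orthogonal to N;
    -- being orthogonal to ∇f as well, it is orthogonal to itself.
    have hNg : N q = (σ q / ‖ambGrad f q‖ ^ 2) • ambGrad f q := by
      set w := N q - (σ q / ‖ambGrad f q‖ ^ 2) • ambGrad f q with hw
      have h2 : ⟪ambGrad f q, w⟫_ℝ = 0 := by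
        rw [hw, inner_sub_right, inner_smul_right, real_inner_self_eq_norm_sq,
          div_mul_cancel₀ _ (pow_ne_zero 2 (hg0 q hq.2)), real_inner_comm, sub_self]
      have h1 : w ∈ tangent S q := by
        rw [hker]; exact (inner_ambGrad f q w).symm.trans h2
      have h3 := hN.orthogonal q hq.1 w h1
      have h4 : ⟪w, w⟫_ℝ = 0 := by
        nth_rewrite 2 [hw]
        rw [inner_sub_right, h3, inner_smul_right, real_inner_comm, h2]; simp
      exact sub_eq_zero.1 (inner_self_eq_zero.1 h4)
    have e1 : ‖N q‖ = |σ q| / ‖ambGrad f q‖ ^ 2 * ‖ambGrad f q‖ := by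
      conv_lhs => rw [hNg]
      rw [norm_smul, Real.norm_eq_abs, abs_div, abs_of_nonneg (sq_nonneg ‖ambGrad f q‖)]
    rw [hN.norm_eq_one q hq.1] at e1
    have e2 : |σ q| = ‖ambGrad f q‖ := by
      have := hg0 q hq.2
      field_simp at e1
      linarith
    refine ⟨?_, e2⟩
    conv_rhs => rw [hNg]
    rw [smul_smul, ← e2, sq_abs]
    have : σ q ≠ 0 := by
      intro h; rw [h, abs_zero] at e2; exact hg0 q hq.2 e2.symm
    field_simp
    simp
  have hσp : σ p ≠ 0 := by
    intro h
    have := (key p ⟨hp, hpU⟩).2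
    rw [h, abs_zero] at this
    exact hg0 p hpU this.symm
  have hσc : ContinuousWithinAt σ S p := by
    refine (hN.continuousOn p hp).inner ?_
    exact (hg.continuousOn.continuousAt (hU.mem_nhds hpU)).continuousWithinAt
  have hpos : ∀ᶠ q in 𝓝[S] p, 0 < σ q * σ p :=
    (hσc.mul continuousWithinAt_const).eventually (lt_mem_nhds (mul_self_pos.2 hσp))
  obtain ⟨V, hV, hpV, hVs⟩ := mem_nhdsWithin.1 hpos
  -- Continuity of N fixes the sign of ⟨N, ∇f⟩ on S near p, so N = ±∇f/|∇f| with a constant sign,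
  -- which is smooth.
  refine ⟨U ∩ V, Set.inter_subset_left, hU.inter hV, ⟨hpU, hpV⟩,
    fun q => SignType.sign (σ p) * ‖ambGrad f q‖⁻¹, ?_, ?_⟩
  · exact contDiffOn_const.mul
      ((hnorm.inv fun q hq => hg0 q hq).mono Set.inter_subset_left)
  · rintro q ⟨hqS, hqU, hqV⟩
    obtain ⟨h1, h2⟩ := key q ⟨hqS, hqU⟩
    have h3 : 0 < σ q * σ p := hVs ⟨hqV, hqS⟩
    have h4 : (SignType.sign (σ p) : ℝ) * |σ q| = σ q := by
      rcases lt_or_gt_of_ne hσp with h | h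
      · have : σ q < 0 := by nlinarith
        simp [sign_neg h, abs_of_neg this]
      · have : 0 < σ q := by nlinarith
        simp [sign_pos h, abs_of_pos this]
    have h5 : σ q ≠ 0 := by rintro h; simp [h] at h3
    show N q = ((SignType.sign (σ p) : ℝ) * ‖ambGrad f q‖⁻¹) • ambGrad f q
    rw [← h2]
    conv_rhs => rw [h1]
    rw [smul_smul]
    have : (SignType.sign (σ p) : ℝ) * |σ q|⁻¹ * σ q = 1 := by
      have h6 : |σ q| ≠ 0 := abs_ne_zero.2 h5
      field_simp
      nth_rewrite 1 [← h4]
      rcases lt_or_gt_of_ne hσp with h | h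
      · simp [sign_neg h]
      · simp [sign_pos h]
    rw [this, one_smul]

theorem IsUnitNormal.mem_tangent_iff {N : Amb n → Amb n} (hN : IsUnitNormal S N)
    (hS : IsSmoothHypersurface S) {p : Amb n} (hp : p ∈ S) {v : Amb n} :
    v ∈ tangent S p ↔ ⟪v, N p⟫_ℝ = 0 := by
  refine ⟨hN.orthogonal p hp v, fun h => ?_⟩
  obtain ⟨U, hU, hpU, f, hf, hf', hSU⟩ := hS p hp
  obtain ⟨V, -, -, hpV, c, -, he⟩ := hN.exists_eq_smul_ambGrad hp hU hpU hf hf' hSU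
  have h1 : N p = c p • ambGrad f p := he ⟨hp, hpV⟩
  have hc : c p ≠ 0 := by
    intro h0
    have := hN.norm_eq_one p hp
    simp [h1, h0] at this
  rw [tangent_eq_ker hp hU hpU hf (hf' p hpU) hSU]
  rw [h1, inner_smul_right, real_inner_comm, inner_ambGrad] at h
  exact (mul_eq_zero.1 h).resolve_left hc

theorem IsUnitNormal.inner_self {N : Amb n → Amb n} (hN : IsUnitNormal S N) {p : Amb n}
    (hp : p ∈ S) : ⟪N p, N p⟫_ℝ = 1 := by
  rw [real_inner_self_eq_norm_sq, hN.norm_eq_one p hp]; norm_num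

theorem IsUnitNormal.proj_apply {N : Amb n → Amb n} (hN : IsUnitNormal S N)
    (hS : IsSmoothHypersurface S) {p : Amb n} (hp : p ∈ S) (v : Amb n) :
    proj S p v = v - ⟪v, N p⟫_ℝ • N p := by
  refine (Submodule.eq_starProjection_of_mem_of_inner_eq_zero (K := tangent S p) ?_
    fun w hw => ?_)
  · rw [hN.mem_tangent_iff hS hp, inner_sub_left, inner_smul_left, hN.inner_self hp]; simp
  · rw [sub_sub_cancel, inner_smul_left, real_inner_comm w (N p), hN.orthogonal p hp w hw]; simp

theorem IsUnitNormal.smoothOn {N : Amb n → Amb n} (hN : IsUnitNormal S N)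
    (hS : IsSmoothHypersurface S) : SmoothOn S N := by
  intro p hp
  obtain ⟨U, hU, hpU, f, hf, hf', hSU⟩ := hS p hp
  obtain ⟨V, hVU, hV, hpV, c, hc, he⟩ := hN.exists_eq_smul_ambGrad hp hU hpU hf hf' hSU
  exact ⟨V, hV, hpV, _, hc.smul ((contDiffOn_ambGrad hU hf).mono hVU), he⟩

theorem IsUnitNormal.smoothOn_proj {N : Amb n → Amb n} (hN : IsUnitNormal S N)
    (hS : IsSmoothHypersurface S) : SmoothOn S (proj S) := by
  have h : SmoothOn S (fun q => ContinuousLinearMap.id ℝ (Amb n) -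
      ContinuousLinearMap.smulRight (InnerProductSpace.toDual ℝ (Amb n) (N q)) (N q)) := by
    refine (smoothOn_const _).sub ?_
    refine SmoothOn.comp (Φ := fun x : Amb n =>
      ContinuousLinearMap.smulRight (InnerProductSpace.toDual ℝ (Amb n) x) x) ?_ (hN.smoothOn hS)
    exact ((InnerProductSpace.toDual ℝ (Amb n)).contDiff).smulRight contDiff_id
  refine h.congr fun q hq => ?_
  ext1 v
  rw [hN.proj_apply hS hq]
  simp [real_inner_comm]

/-- Write N = c∇f near p. For tangent v the derivative of c is multiplied by Df(v) = 0, which leaves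
c D²f(u, v), symmetric in u and v. -/
theorem IsUnitNormal.inner_tgrad_comm {N : Amb n → Amb n} (hN : IsUnitNormal S N)
    (hS : IsSmoothHypersurface S) {p : Amb n} (hp : p ∈ S) {u v : Amb n}
    (hu : u ∈ tangent S p) (hv : v ∈ tangent S p) :
    ⟪tgrad S N p u, v⟫_ℝ = ⟪tgrad S N p v, u⟫_ℝ := by
  obtain ⟨U, hU, hpU, f, hf, hf', hSU⟩ := hS p hp
  obtain ⟨V, hVU, hV, hpV, c, hc, he⟩ := hN.exists_eq_smul_ambGrad hp hU hpU hf hf' hSU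
  have hker := tangent_eq_ker hp hU hpU hf (hf' p hpU) hSU
  have hfd : HasFDerivAt (fderiv ℝ f) (fderiv ℝ (fderiv ℝ f) p) p :=
    (((hf.fderiv_of_isOpen hU (m := ∞) (by simp)).contDiffAt
      (hU.mem_nhds hpU)).differentiableAt (by simp)).hasFDerivAt
  have hcd : HasFDerivAt c (fderiv ℝ c p) p :=
    ((hc.contDiffAt (hV.mem_nhds hpV)).differentiableAt (by simp)).hasFDerivAt
  have hsymm : IsSymmSndFDerivAt ℝ f p := by
    refine (hf.contDiffAt (hU.mem_nhds hpU)).isSymmSndFDerivAt ?_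
    simp only [minSmoothness_of_isRCLikeNormedField]
    exact WithTop.coe_le_coe.2 le_top
  have key : ∀ u ∈ tangent S p, ∀ v ∈ tangent S p,
      ⟪tgrad S N p u, v⟫_ℝ = c p * fderiv ℝ (fderiv ℝ f) p u v := by
    intro u hu v hv
    rw [← tgrad_inner_const ((hN.smoothOn hS).differentiableWithinAt hp)]
    have h2 : HasFDerivAt (fun q => c q * fderiv ℝ f q v)
        (c p • (fderiv ℝ (fderiv ℝ f) p).flip v + (fderiv ℝ f p v) • fderiv ℝ c p) p := by
      refine (hcd.mul (hfd.clm_apply (hasFDerivAt_const v p))).congr_fderiv ?_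
      simp
    have h3 : HasFDerivWithinAt (fun q => ⟪N q, v⟫_ℝ)
        (c p • (fderiv ℝ (fderiv ℝ f) p).flip v + (fderiv ℝ f p v) • fderiv ℝ c p) S p := by
      refine h2.hasFDerivWithinAt.congr_of_eventuallyEq ?_ ?_
      · filter_upwards [self_mem_nhdsWithin,
          mem_nhdsWithin_of_mem_nhds (hV.mem_nhds hpV)] with q h1 h2
        rw [he ⟨h1, h2⟩]
        simp only [inner_smul_left, inner_ambGrad]; rfl
      · rw [he ⟨hp, hpV⟩]
        simp only [inner_smul_left, inner_ambGrad]; rfl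
    rw [tgrad_eq h3, proj_eq_self hu]
    rw [hker] at hv
    have hv' : fderiv ℝ f p v = 0 := hv
    simp [hv']
  rw [key u hu v hv, key v hv u hu, hsymm.eq]

end Geometry

end LambdaHypersurface

/-! ### The endomorphism W = DN, its derivatives, and the Codazzi equation. -/

namespace LambdaHypersurface

variable {n : ℕ} {S : Set (Amb n)} {N : Amb n → Amb n} {p : Amb n}

section Shape

open Filter Topology

/-- A smooth hypersurface together with a unit normal field. -/
structure IsOriented (S : Set (Amb n)) (N : Amb n → Amb n) : Prop where
  smooth : IsSmoothHypersurface S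
  normal : IsUnitNormal S N

/-- The derivative `w ↦ D_w N` of the unit normal. -/
noncomputable def shape (S : Set (Amb n)) (N : Amb n → Amb n) (p : Amb n) : Amb n →L[ℝ] Amb n :=
  tgrad S N p

/-- The derivative `w ↦ D_w W` of `W = DN`. -/
noncomputable def dShape (S : Set (Amb n)) (N : Amb n → Amb n) (p : Amb n) :
    Amb n →L[ℝ] Amb n →L[ℝ] Amb n :=
  tgrad S (shape S N) p

/-- The second derivative `D_z (D_w W)` of `W = DN`. -/
noncomputable def ddShape (S : Set (Amb n)) (N : Amb n → Amb n) (p z w : Amb n) :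
    Amb n →L[ℝ] Amb n :=
  tgrad S (fun q => dShape S N q w) p z

namespace IsOriented

theorem mem_tangent_iff (h : IsOriented S N) (hp : p ∈ S) {v : Amb n} :
    v ∈ tangent S p ↔ ⟪v, N p⟫_ℝ = 0 :=
  h.normal.mem_tangent_iff h.smooth hp

theorem inner_normal (h : IsOriented S N) (hp : p ∈ S) {v : Amb n} (hv : v ∈ tangent S p) :
    ⟪v, N p⟫_ℝ = 0 :=
  (h.mem_tangent_iff hp).1 hv

theorem proj_apply (h : IsOriented S N) (hp : p ∈ S) (v : Amb n) :
    proj S p v = v - ⟪v, N p⟫_ℝ • N p :=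
  h.normal.proj_apply h.smooth hp v

theorem proj_normal (h : IsOriented S N) (hp : p ∈ S) : proj S p (N p) = 0 := by
  rw [h.proj_apply hp, h.normal.inner_self hp]; simp

theorem smoothOn_normal (h : IsOriented S N) : SmoothOn S N := h.normal.smoothOn h.smooth

theorem smoothOn_proj (h : IsOriented S N) : SmoothOn S (proj S) :=
  h.normal.smoothOn_proj h.smooth

theorem smoothOn_shape (h : IsOriented S N) : SmoothOn S (shape S N) :=
  h.smoothOn_normal.tgrad h.smoothOn_proj

theorem smoothOn_dShape (h : IsOriented S N) : SmoothOn S (dShape S N) :=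
  h.smoothOn_shape.tgrad h.smoothOn_proj

theorem smoothOn_shape_apply (h : IsOriented S N) (v : Amb n) :
    SmoothOn S (fun q => shape S N q v) :=
  h.smoothOn_shape.clm_apply (smoothOn_const v)

theorem smoothOn_dShape_apply (h : IsOriented S N) (w : Amb n) :
    SmoothOn S (fun q => dShape S N q w) :=
  h.smoothOn_dShape.clm_apply (smoothOn_const w)

theorem smoothOn_dShape_apply₂ (h : IsOriented S N) (w v : Amb n) :
    SmoothOn S (fun q => dShape S N q w v) :=
  (h.smoothOn_dShape_apply w).clm_apply (smoothOn_const v)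

theorem tgrad_shape_apply (h : IsOriented S N) (hp : p ∈ S) (v w : Amb n) :
    tgrad S (fun q => shape S N q v) p w = dShape S N p w v :=
  tgrad_apply_const (h.smoothOn_shape.differentiableWithinAt hp) v w

theorem tgrad_dShape_apply (h : IsOriented S N) (hp : p ∈ S) (v w z : Amb n) :
    tgrad S (fun q => dShape S N q w v) p z = ddShape S N p z w v :=
  tgrad_apply_const ((h.smoothOn_dShape_apply w).differentiableWithinAt hp) v z

theorem shape_proj (v : Amb n) : shape S N p (proj S p v) = shape S N p v :=
  tgrad_proj N p v

theorem dShape_proj (v : Amb n) : dShape S N p (proj S p v) = dShape S N p v :=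
  tgrad_proj _ p v

theorem shape_normal (h : IsOriented S N) (hp : p ∈ S) : shape S N p (N p) = 0 := by
  rw [← shape_proj, h.proj_normal hp, map_zero]

theorem inner_shape_normal (h : IsOriented S N) (hp : p ∈ S) (w : Amb n) :
    ⟪shape S N p w, N p⟫_ℝ = 0 := by
  have hd := h.smoothOn_normal.differentiableWithinAt hp
  have h1 := tgrad_inner hd hd w
  rw [tgrad_congr hp (F' := fun _ => (1 : ℝ)) (fun q hq => h.normal.inner_self hq),
    tgrad_const, real_inner_comm] at h1
  change 0 = ⟪N p, shape S N p w⟫_ℝ + ⟪N p, shape S N p w⟫_ℝ at h1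
  rw [real_inner_comm]
  linarith

theorem shape_mem (h : IsOriented S N) (hp : p ∈ S) (w : Amb n) :
    shape S N p w ∈ tangent S p :=
  (h.mem_tangent_iff hp).2 (h.inner_shape_normal hp w)

theorem inner_shape_comm (h : IsOriented S N) (hp : p ∈ S) (u v : Amb n) :
    ⟪shape S N p u, v⟫_ℝ = ⟪u, shape S N p v⟫_ℝ := by
  have h1 : ∀ u v, ⟪shape S N p u, v⟫_ℝ = ⟪shape S N p (proj S p u), proj S p v⟫_ℝ := by
    intro u v
    rw [shape_proj, h.proj_apply hp v, inner_sub_right, inner_smul_right,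
      h.inner_shape_normal hp]
    simp
  rw [real_inner_comm _ u, h1 u v, h1 v u]
  exact h.normal.inner_tgrad_comm h.smooth hp (proj_mem p u) (proj_mem p v)

/-- Product rule for the projection u - ⟨u, N⟩N. -/
theorem tgrad_proj_apply (h : IsOriented S N) (hp : p ∈ S) (u w : Amb n) :
    tgrad S (fun q => proj S q u) p w =
      -(⟪shape S N p w, u⟫_ℝ • N p + ⟪u, N p⟫_ℝ • shape S N p w) := by
  have hd := h.smoothOn_normal.differentiableWithinAt hp
  have hi := ((smoothOn_const u).inner h.smoothOn_normal).differentiableWithinAt hp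
  rw [tgrad_congr hp (F' := fun q => u - ⟪u, N q⟫_ℝ • N q) (fun q hq => h.proj_apply hq u),
    tgrad_sub (differentiableWithinAt_const _) (hi.fun_smul hd), tgrad_const,
    tgrad_smul hi hd, tgrad_const_inner hd, zero_sub, real_inner_comm]
  rfl

/-- The commutator of two derivatives along `S` in constant directions. -/
theorem tgrad_tgrad_sub {G : Type*} [NormedAddCommGroup G] [NormedSpace ℝ G]
    (h : IsOriented S N) {F : Amb n → G} (hF : SmoothOn S F) (hp : p ∈ S) (w u : Amb n) :
    tgrad S (fun q => tgrad S F q u) p w - tgrad S (fun q => tgrad S F q w) p u =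
      ⟪w, N p⟫_ℝ • tgrad S F p (shape S N p u) - ⟪u, N p⟫_ℝ • tgrad S F p (shape S N p w) := by
  obtain ⟨U, hU, hpU, F', hF', he⟩ := hF p hp
  have hFq : ∀ q ∈ S ∩ U, ∀ v, tgrad S F q v = fderiv ℝ F' q (proj S q v) := by
    intro q hq v
    refine tgrad_eq ?_ v
    refine (((hF'.contDiffAt (hU.mem_nhds hq.2)).differentiableAt
      (by simp)).hasFDerivAt.hasFDerivWithinAt).congr_of_eventuallyEq ?_ (he hq)
    filter_upwards [self_mem_nhdsWithin,
      mem_nhdsWithin_of_mem_nhds (hU.mem_nhds hq.2)] with r h1 h2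
    exact he ⟨h1, h2⟩
  have hM : HasFDerivAt (fderiv ℝ F') (fderiv ℝ (fderiv ℝ F') p) p :=
    (((hF'.fderiv_of_isOpen hU (m := ∞) (by simp)).contDiffAt
      (hU.mem_nhds hpU)).differentiableAt (by simp)).hasFDerivAt
  have hsymm : IsSymmSndFDerivAt ℝ F' p := by
    refine (hF'.contDiffAt (hU.mem_nhds hpU)).isSymmSndFDerivAt ?_
    simp only [minSmoothness_of_isRCLikeNormedField]
    exact WithTop.coe_le_coe.2 le_top
  -- With F' a smooth local extension, the derivative is DF' applied to the projection of u, so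
  -- differentiating again also hits the projection. In the commutator D²F' and the term ⟨W w, u⟩
  -- DF'(N) cancel by symmetry.
  have key : ∀ w u, tgrad S (fun q => tgrad S F q u) p w =
      fderiv ℝ (fderiv ℝ F') p (proj S p w) (proj S p u) -
        fderiv ℝ F' p (⟪shape S N p w, u⟫_ℝ • N p + ⟪u, N p⟫_ℝ • shape S N p w) := by
    intro w u
    have h1 : (fun q => tgrad S F q u) =ᶠ[𝓝[S] p] fun q => fderiv ℝ F' q (proj S q u) := by
      filter_upwards [self_mem_nhdsWithin,
        mem_nhdsWithin_of_mem_nhds (hU.mem_nhds hpU)] with q h1 h2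
      exact hFq q ⟨h1, h2⟩ u
    have h2 : tgrad S (fun q => tgrad S F q u) p =
        tgrad S (fun q => fderiv ℝ F' q (proj S q u)) p := by
      rw [tgrad, h1.fderivWithin_eq (h1.self_of_nhdsWithin hp), ← tgrad]
    rw [h2, tgrad_clm_apply hM.hasFDerivWithinAt.differentiableWithinAt
      ((h.smoothOn_proj.clm_apply (smoothOn_const u)).differentiableWithinAt hp),
      h.tgrad_proj_apply hp, tgrad_eq hM.hasFDerivWithinAt, map_neg, sub_eq_add_neg]
  rw [key, key, hFq p ⟨hp, hpU⟩, hFq p ⟨hp, hpU⟩, proj_eq_self (h.shape_mem hp u),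
    proj_eq_self (h.shape_mem hp w), hsymm.eq (proj S p w), h.inner_shape_comm hp w u,
    real_inner_comm w]
  simp only [map_add, map_smul]
  abel

theorem tgrad_tgrad_comm {G : Type*} [NormedAddCommGroup G] [NormedSpace ℝ G]
    (h : IsOriented S N) {F : Amb n → G} (hF : SmoothOn S F) (hp : p ∈ S) {w u : Amb n}
    (hw : w ∈ tangent S p) (hu : u ∈ tangent S p) :
    tgrad S (fun q => tgrad S F q u) p w = tgrad S (fun q => tgrad S F q w) p u := by
  rw [← sub_eq_zero, h.tgrad_tgrad_sub hF hp, h.inner_normal hp hw, h.inner_normal hp hu]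
  simp

theorem inner_dShape_comm (h : IsOriented S N) (hp : p ∈ S) (w u v : Amb n) :
    ⟪dShape S N p w u, v⟫_ℝ = ⟪u, dShape S N p w v⟫_ℝ := by
  rw [← h.tgrad_shape_apply hp, ← h.tgrad_shape_apply hp,
    ← tgrad_inner_const ((h.smoothOn_shape_apply u).differentiableWithinAt hp),
    ← tgrad_const_inner ((h.smoothOn_shape_apply v).differentiableWithinAt hp),
    tgrad_congr hp (fun q hq => h.inner_shape_comm hq u v)]

theorem inner_ddShape_comm (h : IsOriented S N) (hp : p ∈ S) (z w u v : Amb n) :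
    ⟪ddShape S N p z w u, v⟫_ℝ = ⟪u, ddShape S N p z w v⟫_ℝ := by
  rw [← h.tgrad_dShape_apply hp, ← h.tgrad_dShape_apply hp,
    ← tgrad_inner_const ((h.smoothOn_dShape_apply₂ w u).differentiableWithinAt hp),
    ← tgrad_const_inner ((h.smoothOn_dShape_apply₂ w v).differentiableWithinAt hp),
    tgrad_congr hp (fun q hq => h.inner_dShape_comm hq w u v)]

/-- Differentiate W N = 0. -/
theorem dShape_normal (h : IsOriented S N) (hp : p ∈ S) (w : Amb n) :
    dShape S N p w (N p) = -shape S N p (shape S N p w) := by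
  have h1 := tgrad_clm_apply (h.smoothOn_shape.differentiableWithinAt hp)
    (h.smoothOn_normal.differentiableWithinAt hp) w
  rw [tgrad_congr hp (F' := fun _ => (0 : Amb n)) (fun q hq => h.shape_normal hq),
    tgrad_const] at h1
  exact (neg_eq_of_add_eq_zero_left h1.symm).symm

/-- The Codazzi equation. -/
theorem dShape_sub (h : IsOriented S N) (hp : p ∈ S) (w u : Amb n) :
    dShape S N p w u - dShape S N p u w =
      ⟪w, N p⟫_ℝ • shape S N p (shape S N p u) - ⟪u, N p⟫_ℝ • shape S N p (shape S N p w) := by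
  rw [← h.tgrad_shape_apply hp, ← h.tgrad_shape_apply hp]
  exact h.tgrad_tgrad_sub h.smoothOn_normal hp w u

theorem dShape_comm (h : IsOriented S N) (hp : p ∈ S) {w u : Amb n} (hw : w ∈ tangent S p)
    (hu : u ∈ tangent S p) : dShape S N p w u = dShape S N p u w := by
  rw [← sub_eq_zero, h.dShape_sub hp, h.inner_normal hp hw, h.inner_normal hp hu]; simp

theorem ddShape_comm (h : IsOriented S N) (hp : p ∈ S) {z w : Amb n} (hz : z ∈ tangent S p)
    (hw : w ∈ tangent S p) : ddShape S N p z w = ddShape S N p w z :=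
  h.tgrad_tgrad_comm h.smoothOn_shape hp hz hw

/-- Differentiate the Codazzi equation, which holds for all constant ambient vectors, in the
direction z. The factors ⟨w, N⟩ and ⟨u, N⟩ vanish at p but their derivatives do not; these are the
source of the cubic terms in Simons' identity. -/
theorem ddShape_sub (h : IsOriented S N) (hp : p ∈ S) {z w u : Amb n}
    (hw : w ∈ tangent S p) (hu : u ∈ tangent S p) :
    ddShape S N p z w u - ddShape S N p z u w =
      ⟪w, shape S N p z⟫_ℝ • shape S N p (shape S N p u) -
        ⟪u, shape S N p z⟫_ℝ • shape S N p (shape S N p w) := by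
  have hd : ∀ w u, tgrad S (fun q => ⟪w, N q⟫_ℝ • shape S N q (shape S N q u)) p z =
      ⟪w, shape S N p z⟫_ℝ • shape S N p (shape S N p u) +
      ⟪w, N p⟫_ℝ • tgrad S (fun q => shape S N q (shape S N q u)) p z := by
    intro w u
    rw [tgrad_smul (((smoothOn_const w).inner h.smoothOn_normal).differentiableWithinAt hp)
      ((h.smoothOn_shape.clm_apply (h.smoothOn_shape_apply u)).differentiableWithinAt hp),
      tgrad_const_inner (h.smoothOn_normal.differentiableWithinAt hp)]
    rfl
  have hs : ∀ w u, SmoothOn S (fun q => ⟪w, N q⟫_ℝ • shape S N q (shape S N q u)) := fun w u =>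
    ((smoothOn_const w).inner h.smoothOn_normal).smul
      (h.smoothOn_shape.clm_apply (h.smoothOn_shape_apply u))
  have h1 := DFunLike.congr_fun (tgrad_congr hp fun q hq => h.dShape_sub hq w u) z
  rw [tgrad_sub ((h.smoothOn_dShape_apply₂ w u).differentiableWithinAt hp)
    ((h.smoothOn_dShape_apply₂ u w).differentiableWithinAt hp), h.tgrad_dShape_apply hp,
    h.tgrad_dShape_apply hp, tgrad_sub ((hs w u).differentiableWithinAt hp)
    ((hs u w).differentiableWithinAt hp), hd, hd, h.inner_normal hp hw, h.inner_normal hp hu] at h1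
  simpa using h1

theorem inner_dShape_normal (h : IsOriented S N) (hp : p ∈ S) (w u : Amb n) :
    ⟪dShape S N p w u, N p⟫_ℝ = -⟪shape S N p u, shape S N p w⟫_ℝ := by
  rw [h.inner_dShape_comm hp, h.dShape_normal hp, inner_neg_right, ← h.inner_shape_comm hp]

/-- Differentiate ⟨(D_v W)N, N⟩ = 0, valid on S because (D_v W)N = -W²v is tangent. -/
theorem inner_ddShape_normal_normal (h : IsOriented S N) (hp : p ∈ S) (u v : Amb n) :
    ⟪ddShape S N p u v (N p), N p⟫_ℝ =
      2 * ⟪shape S N p u, shape S N p (shape S N p v)⟫_ℝ := by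
  have hn := h.smoothOn_normal.differentiableWithinAt hp
  have hR := (h.smoothOn_dShape_apply v).differentiableWithinAt hp
  have h1 := tgrad_inner ((h.smoothOn_dShape_apply v).clm_apply
    h.smoothOn_normal |>.differentiableWithinAt hp) hn u
  rw [tgrad_congr hp (F' := fun _ => (0 : ℝ)), tgrad_const, tgrad_clm_apply hR hn] at h1
  · change 0 = ⟪ddShape S N p u v (N p) + dShape S N p v (shape S N p u), N p⟫_ℝ +
      ⟪dShape S N p v (N p), shape S N p u⟫_ℝ at h1
    rw [inner_add_left, h.inner_dShape_comm hp v (shape S N p u), h.dShape_normal hp,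
      inner_neg_right, inner_neg_left, real_inner_comm (shape S N p u)] at h1
    linarith
  · intro q hq
    show ⟪dShape S N q v (N q), N q⟫_ℝ = 0
    rw [h.dShape_normal hq, inner_neg_left, h.inner_shape_normal hq, neg_zero]

end IsOriented

end Shape

end LambdaHypersurface

/-! ### Traces, and the tensors of the statement expressed through W. -/

namespace LambdaHypersurface

variable {n : ℕ} {S : Set (Amb n)} {N : Amb n → Amb n} {p : Amb n}

/-- The standard orthonormal basis of the ambient space. -/
noncomputable def stdVec (j : Fin (n + 1)) : Amb n := EuclideanSpace.basisFun (Fin (n + 1)) ℝ j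

/-- A vector of the orthonormal basis of `T_p S`, as a vector of the ambient space. -/
noncomputable def frameVec (S : Set (Amb n)) (p : Amb n)
    (i : Fin (Module.finrank ℝ (tangent S p))) : Amb n := frame S p i

theorem frameVec_mem (i : Fin (Module.finrank ℝ (tangent S p))) :
    frameVec S p i ∈ tangent S p := (frame S p i).2

theorem sum_frameVec_of_mem {v : Amb n} (hv : v ∈ tangent S p) :
    ∑ i, ⟪frameVec S p i, v⟫_ℝ • frameVec S p i = v := by
  have := congrArg (Subtype.val) ((frame S p).sum_repr' ⟨v, hv⟩)
  simpa [frameVec] using this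

theorem inner_frameVec_proj (i : Fin (Module.finrank ℝ (tangent S p))) (v : Amb n) :
    ⟪frameVec S p i, proj S p v⟫_ℝ = ⟪frameVec S p i, v⟫_ℝ := by
  rw [proj, ← Submodule.inner_starProjection_left_eq_right]
  exact congrArg (⟪·, v⟫_ℝ) (proj_eq_self (frameVec_mem i))

theorem sum_frameVec (v : Amb n) :
    ∑ i, ⟪frameVec S p i, v⟫_ℝ • frameVec S p i = proj S p v := by
  simpa only [inner_frameVec_proj] using sum_frameVec_of_mem (proj_mem p v)

theorem sum_stdVec_inner_mul (u x : Amb n) (Y : Amb n →L[ℝ] Amb n) :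
    ∑ j, ⟪u, stdVec j⟫_ℝ * ⟪x, Y (stdVec j)⟫_ℝ = ⟪x, Y u⟫_ℝ := by
  conv_rhs => rw [← (EuclideanSpace.basisFun (Fin (n + 1)) ℝ).sum_repr' u]
  simp only [map_sum, map_smul, inner_sum, inner_smul_right, stdVec]
  exact Finset.sum_congr rfl fun j _ => by rw [real_inner_comm]

theorem sum_fin_two {α : Type*} [Fintype α] (F : (Fin 2 → α) → ℝ) :
    ∑ c, F c = ∑ i, ∑ j, F ![i, j] := by
  rw [← (finTwoArrowEquiv α).symm.sum_comp, Fintype.sum_prod_type]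
  rfl

theorem sum_fin_three {α : Type*} [Fintype α] (F : (Fin 3 → α) → ℝ) :
    ∑ c, F c = ∑ i, ∑ j, ∑ k, F ![i, j, k] := by
  rw [← (Fin.consEquiv fun _ : Fin 3 => α).sum_comp, Fintype.sum_prod_type]
  refine Finset.sum_congr rfl fun i _ => ?_
  rw [sum_fin_two]
  rfl

theorem laplacian_scalar (f : Amb n → ℝ) (v : Fin 0 → Amb n) :
    laplacian S (scalar f) p v =
      ∑ i, tgrad S (fun q => tgrad S f q (frameVec S p i)) p (frameVec S p i) :=
  Finset.sum_congr rfl fun i _ => dirDeriv_eq_tgrad _ (frameVec_mem i)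

theorem nablaPos_scalar (f : Amb n → ℝ) (v : Fin 0 → Amb n) :
    nablaPos S (scalar f) p v = tgrad S f p p := rfl

namespace IsOriented

theorem sum_frameVec_inner_mul (h : IsOriented S N) (hp : p ∈ S) (x y : Amb n) :
    ∑ i, ⟪frameVec S p i, x⟫_ℝ * ⟪frameVec S p i, y⟫_ℝ = ⟪x, y⟫_ℝ - ⟪x, N p⟫_ℝ * ⟪y, N p⟫_ℝ := by
  have h1 : ⟪proj S p x, y⟫_ℝ = ⟪x, y⟫_ℝ - ⟪x, N p⟫_ℝ * ⟪y, N p⟫_ℝ := by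
    rw [h.proj_apply hp, inner_sub_left, real_inner_smul_left, real_inner_comm (N p) y]
  rw [← h1, ← sum_frameVec x, sum_inner]
  simp only [real_inner_smul_left]

theorem sum_frameVec_inner_mul_of_mem (h : IsOriented S N) (hp : p ∈ S) {x : Amb n}
    (hx : x ∈ tangent S p) (y : Amb n) :
    ∑ i, ⟪frameVec S p i, x⟫_ℝ * ⟪frameVec S p i, y⟫_ℝ = ⟪x, y⟫_ℝ := by
  rw [h.sum_frameVec_inner_mul hp, h.inner_normal hp hx]; ring

/-- The pairing tr(XᵀY) does not depend on the orthonormal basis, and a basis of T_p S together with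
N is one. The fixed basis can be differentiated through, whereas the frames are chosen point by
point with no continuity. -/
theorem sum_stdVec_inner (h : IsOriented S N) (hp : p ∈ S) (X Y : Amb n →L[ℝ] Amb n) :
    ∑ j, ⟪X (stdVec j), Y (stdVec j)⟫_ℝ =
      ∑ i, ⟪X (frameVec S p i), Y (frameVec S p i)⟫_ℝ + ⟪X (N p), Y (N p)⟫_ℝ := by
  have h1 : ∀ j, ⟪X (stdVec j), Y (stdVec j)⟫_ℝ =
      ∑ i, ⟪frameVec S p i, stdVec j⟫_ℝ * ⟪X (frameVec S p i), Y (stdVec j)⟫_ℝ +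
        ⟪N p, stdVec j⟫_ℝ * ⟪X (N p), Y (stdVec j)⟫_ℝ := by
    intro j
    have h2 : stdVec j = ∑ i, ⟪frameVec S p i, stdVec j⟫_ℝ • frameVec S p i +
        ⟪N p, stdVec j⟫_ℝ • N p := by
      rw [sum_frameVec, h.proj_apply hp, real_inner_comm]; simp
    have h3 := congrArg (fun w => ⟪X w, Y (stdVec j)⟫_ℝ) h2
    simpa only [map_add, map_sum, map_smul, inner_add_left, sum_inner,
      real_inner_smul_left] using h3
  simp only [h1, Finset.sum_add_distrib]
  rw [Finset.sum_comm]
  simp only [sum_stdVec_inner_mul]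

theorem sum_stdVec_inner_self (h : IsOriented S N) (hp : p ∈ S) (X : Amb n →L[ℝ] Amb n) :
    ∑ j, ⟪X (stdVec j), stdVec j⟫_ℝ =
      ∑ i, ⟪X (frameVec S p i), frameVec S p i⟫_ℝ + ⟪X (N p), N p⟫_ℝ :=
  h.sum_stdVec_inner hp X (ContinuousLinearMap.id ℝ _)

theorem sff_apply (h : IsOriented S N) (hp : p ∈ S) {v : Fin 2 → Amb n}
    (hv : v 0 ∈ tangent S p) : sff S N p v = -⟪shape S N p (v 0), v 1⟫_ℝ := by
  change ⟪dirDeriv S (fun q => proj S q (v 1)) p (v 0), N p⟫_ℝ = _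
  rw [dirDeriv_eq_tgrad _ hv, h.tgrad_proj_apply hp, inner_neg_left, inner_add_left,
    real_inner_smul_left, real_inner_smul_left, h.inner_shape_normal hp, h.normal.inner_self hp]
  ring

theorem inner_shape_proj (h : IsOriented S N) (hp : p ∈ S) (u v : Amb n) :
    ⟪shape S N p u, proj S p v⟫_ℝ = ⟪shape S N p u, v⟫_ℝ := by
  rw [h.inner_shape_comm hp, shape_proj, h.inner_shape_comm hp]

/-- W kills normals and has tangent values, so the projections hidden in `ext` drop out and A on the
extended fields is -⟨W v₁, v₂⟩ with constant vectors. -/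
theorem nabla_sff_apply (h : IsOriented S N) (hp : p ∈ S) {v : Fin 3 → Amb n}
    (hv : v 0 ∈ tangent S p) :
    nabla S (sff S N) p v = -⟪dShape S N p (v 0) (v 1), v 2⟫_ℝ := by
  rw [nabla, dirDeriv_congr hp (F' := fun q => -⟪shape S N q (v 1), v 2⟫_ℝ),
    dirDeriv_eq_tgrad _ hv,
    tgrad_neg (((h.smoothOn_shape_apply _).inner (smoothOn_const _)).differentiableWithinAt hp),
    tgrad_inner_const ((h.smoothOn_shape_apply _).differentiableWithinAt hp),
    h.tgrad_shape_apply hp]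
  intro q hq
  show sff S N q (fun i => proj S q (v i.succ)) = _
  rw [h.sff_apply hq (proj_mem q _), shape_proj, h.inner_shape_proj hq]
  rfl

theorem inner_dShape_proj_proj (h : IsOriented S N) (hp : p ∈ S) (w u v : Amb n) :
    ⟪dShape S N p w (proj S p u), proj S p v⟫_ℝ =
      ⟪dShape S N p w u, v⟫_ℝ + ⟪u, N p⟫_ℝ * ⟪shape S N p (shape S N p w), v⟫_ℝ +
        ⟪v, N p⟫_ℝ * ⟪shape S N p (shape S N p w), u⟫_ℝ := by
  rw [h.proj_apply hp u, h.proj_apply hp v]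
  simp only [map_sub, map_smul, h.dShape_normal hp, inner_sub_left, inner_sub_right,
    real_inner_smul_left, real_inner_smul_right, inner_neg_left, h.inner_shape_normal hp,
    h.inner_dShape_normal hp]
  rw [h.inner_shape_comm hp (shape S N p w) u, real_inner_comm (shape S N p w)]
  ring

/-- Unlike W, its derivative does not kill normals, so projecting the last two slots costs terms
with factors ⟨v₂, N⟩ and ⟨v₃, N⟩. These vanish at p, but their derivatives ⟨v₂, W v₀⟩ and ⟨v₃, W v₀⟩
survive. -/
theorem nabla_nabla_sff_apply (h : IsOriented S N) (hp : p ∈ S) {v : Fin 4 → Amb n}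
    (h0 : v 0 ∈ tangent S p) (h2 : v 2 ∈ tangent S p) (h3 : v 3 ∈ tangent S p) :
    nabla S (nabla S (sff S N)) p v =
      -(⟪ddShape S N p (v 0) (v 1) (v 2), v 3⟫_ℝ +
        ⟪v 2, shape S N p (v 0)⟫_ℝ * ⟪shape S N p (shape S N p (v 1)), v 3⟫_ℝ +
        ⟪v 3, shape S N p (v 0)⟫_ℝ * ⟪shape S N p (shape S N p (v 1)), v 2⟫_ℝ) := by
  have hn : ∀ u, SmoothOn S (fun q => ⟪u, N q⟫_ℝ) := fun u =>
    (smoothOn_const u).inner h.smoothOn_normal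
  have hW : ∀ u, SmoothOn S (fun q => ⟪shape S N q (shape S N q (v 1)), u⟫_ℝ) := fun u =>
    (h.smoothOn_shape.clm_apply (h.smoothOn_shape_apply _)).inner (smoothOn_const u)
  have hR : SmoothOn S (fun q => ⟪dShape S N q (v 1) (v 2), v 3⟫_ℝ) :=
    (h.smoothOn_dShape_apply₂ _ _).inner (smoothOn_const _)
  have hd : ∀ u u', u ∈ tangent S p →
      tgrad S (fun q => ⟪u, N q⟫_ℝ * ⟪shape S N q (shape S N q (v 1)), u'⟫_ℝ) p (v 0) =
        ⟪u, shape S N p (v 0)⟫_ℝ * ⟪shape S N p (shape S N p (v 1)), u'⟫_ℝ := by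
    intro u u' hu
    rw [tgrad_mul ((hn u).differentiableWithinAt hp) ((hW u').differentiableWithinAt hp),
      tgrad_const_inner (h.smoothOn_normal.differentiableWithinAt hp), h.inner_normal hp hu]
    simp [shape]
  rw [nabla, dirDeriv_congr hp (F' := fun q => -(⟪dShape S N q (v 1) (v 2), v 3⟫_ℝ +
      ⟪v 2, N q⟫_ℝ * ⟪shape S N q (shape S N q (v 1)), v 3⟫_ℝ +
        ⟪v 3, N q⟫_ℝ * ⟪shape S N q (shape S N q (v 1)), v 2⟫_ℝ)),
    dirDeriv_eq_tgrad _ h0,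
    tgrad_neg (((hR.add ((hn _).mul (hW _))).add ((hn _).mul (hW _))).differentiableWithinAt hp),
    tgrad_add ((hR.add ((hn _).mul (hW _))).differentiableWithinAt hp)
      (((hn _).mul (hW _)).differentiableWithinAt hp),
    tgrad_add (hR.differentiableWithinAt hp) (((hn _).mul (hW _)).differentiableWithinAt hp),
    hd _ _ h2, hd _ _ h3,
    tgrad_inner_const ((h.smoothOn_dShape_apply₂ _ _).differentiableWithinAt hp),
    h.tgrad_dShape_apply hp]
  intro q hq
  show nabla S (sff S N) q (fun i => proj S q (v i.succ)) = _
  rw [h.nabla_sff_apply hq (proj_mem q _)]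
  exact congrArg Neg.neg ((by rw [dShape_proj]; rfl : _ = _).trans
    (h.inner_dShape_proj_proj hq (v 1) (v 2) (v 3)))

theorem nablaPos_sff (h : IsOriented S N) (hp : p ∈ S) (u v : Amb n) :
    nablaPos S (sff S N) p ![u, v] = -⟪dShape S N p p u, v⟫_ℝ := by
  rw [nablaPos, h.nabla_sff_apply hp (proj_mem p p)]
  show -⟪dShape S N p (proj S p p) u, v⟫_ℝ = _
  rw [dShape_proj]

theorem meanCurv_eq :
    meanCurv S N p = ∑ i, ⟪shape S N p (frameVec S p i), frameVec S p i⟫_ℝ :=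
  Finset.sum_congr rfl fun i _ => by rw [dirDeriv_eq_tgrad _ (frame S p i).2]; rfl

theorem meanCurv_eq_sum_stdVec (h : IsOriented S N) (hp : p ∈ S) :
    meanCurv S N p = ∑ j, ⟪shape S N p (stdVec j), stdVec j⟫_ℝ := by
  rw [meanCurv_eq, h.sum_stdVec_inner_self hp, h.shape_normal hp, inner_zero_left, add_zero]

theorem sffNormSq_eq (h : IsOriented S N) (hp : p ∈ S) :
    sffNormSq S N p =
      ∑ i, ⟪shape S N p (frameVec S p i), shape S N p (frameVec S p i)⟫_ℝ := by
  rw [sffNormSq, tensorInner, sum_fin_two]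
  refine Finset.sum_congr rfl fun i _ => ?_
  rw [← h.sum_frameVec_inner_mul_of_mem hp (h.shape_mem hp _)]
  refine Finset.sum_congr rfl fun j _ => ?_
  rw [h.sff_apply hp (frame S p _).2, real_inner_comm, neg_mul_neg]
  rfl

theorem sffNormSq_eq_sum_stdVec (h : IsOriented S N) (hp : p ∈ S) :
    sffNormSq S N p = ∑ j, ⟪shape S N p (stdVec j), shape S N p (stdVec j)⟫_ℝ := by
  rw [h.sffNormSq_eq hp, h.sum_stdVec_inner hp, h.shape_normal hp, inner_zero_left, add_zero]

theorem sffSq_eq (h : IsOriented S N) (hp : p ∈ S) {v : Fin 2 → Amb n}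
    (hv : v 0 ∈ tangent S p) :
    sffSq S N p v = ⟪shape S N p (v 0), shape S N p (v 1)⟫_ℝ := by
  rw [← h.sum_frameVec_inner_mul_of_mem hp (h.shape_mem hp _)]
  refine Finset.sum_congr rfl fun k _ => ?_
  rw [h.sff_apply hp (v := ![v 0, _]) hv, h.sff_apply hp (v := ![_, v 1]) (frame S p k).2,
    neg_mul_neg]
  show ⟪shape S N p (v 0), frameVec S p k⟫_ℝ * ⟪shape S N p (frameVec S p k), v 1⟫_ℝ = _
  rw [h.inner_shape_comm hp (frameVec S p k), real_inner_comm]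

theorem tensorInner_sffSq_sff (h : IsOriented S N) (hp : p ∈ S) :
    tensorInner S (sffSq S N) (sff S N) p =
      -∑ i, ⟪shape S N p (shape S N p (frameVec S p i)), shape S N p (frameVec S p i)⟫_ℝ := by
  rw [tensorInner, sum_fin_two, ← Finset.sum_neg_distrib]
  refine Finset.sum_congr rfl fun i _ => ?_
  rw [← h.sum_frameVec_inner_mul_of_mem hp (h.shape_mem hp _), ← Finset.sum_neg_distrib]
  refine Finset.sum_congr rfl fun j _ => ?_
  rw [h.sffSq_eq hp (frame S p _).2, h.sff_apply hp (frame S p _).2]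
  show ⟪shape S N p (frameVec S p i), shape S N p (frameVec S p j)⟫_ℝ *
    -⟪shape S N p (frameVec S p i), frameVec S p j⟫_ℝ = _
  rw [← h.inner_shape_comm hp, real_inner_comm, mul_neg,
    real_inner_comm (frameVec S p j) (shape S N p (frameVec S p i))]

/-- The Hilbert–Schmidt norm of `D_w W` in terms of its tangential part. -/
theorem sum_stdVec_dShape (h : IsOriented S N) (hp : p ∈ S) {w : Amb n} :
    ∑ j, ⟪dShape S N p w (stdVec j), dShape S N p w (stdVec j)⟫_ℝ =
      ∑ i, ∑ k, ⟪dShape S N p w (frameVec S p i), frameVec S p k⟫_ℝ ^ 2 +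
        2 * ⟪shape S N p (shape S N p w), shape S N p (shape S N p w)⟫_ℝ := by
  have h1 : ∀ x, ⟪x, x⟫_ℝ = ∑ k, ⟪x, frameVec S p k⟫_ℝ ^ 2 + ⟪x, N p⟫_ℝ ^ 2 := by
    intro x
    have := h.sum_frameVec_inner_mul hp x x
    simp only [real_inner_comm x, ← sq] at this ⊢
    linarith
  -- The normal components of the (D_w W)eᵢ and the vector (D_w W)N each contribute |W²w|², hence
  -- the factor 2.
  have h2 : ∑ i, ⟪dShape S N p w (frameVec S p i), N p⟫_ℝ ^ 2 =
      ⟪shape S N p (shape S N p w), shape S N p (shape S N p w)⟫_ℝ := by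
    rw [← h.sum_frameVec_inner_mul_of_mem hp (h.shape_mem hp _)]
    refine Finset.sum_congr rfl fun i _ => ?_
    rw [h.inner_dShape_normal hp, h.inner_shape_comm hp (frameVec S p i)]
    ring
  rw [h.sum_stdVec_inner hp, Finset.sum_congr rfl fun i _ => h1 _, Finset.sum_add_distrib, h2,
    h.dShape_normal hp, inner_neg_neg]
  ring

theorem tensorInner_nabla_sff (h : IsOriented S N) (hp : p ∈ S) :
    tensorInner S (nabla S (sff S N)) (nabla S (sff S N)) p =
      ∑ i, ∑ j, ∑ k,
        ⟪dShape S N p (frameVec S p i) (frameVec S p j), frameVec S p k⟫_ℝ ^ 2 := by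
  rw [tensorInner, sum_fin_three]
  refine Finset.sum_congr rfl fun i _ => Finset.sum_congr rfl fun j _ =>
    Finset.sum_congr rfl fun k _ => ?_
  rw [h.nabla_sff_apply hp (frame S p _).2, neg_mul_neg, ← sq]
  rfl

/-! ### Derivatives of H and |A|², and Simons' identity. -/

theorem tgrad_meanCurv (h : IsOriented S N) (hp : p ∈ S) (v : Amb n) :
    tgrad S (meanCurv S N) p v = ∑ j, ⟪dShape S N p v (stdVec j), stdVec j⟫_ℝ := by
  rw [tgrad_congr hp fun q hq => h.meanCurv_eq_sum_stdVec hq, tgrad_sum fun j _ =>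
    ((h.smoothOn_shape_apply _).inner (smoothOn_const _)).differentiableWithinAt hp]
  refine Finset.sum_congr rfl fun j _ => ?_
  rw [tgrad_inner_const ((h.smoothOn_shape_apply _).differentiableWithinAt hp),
    h.tgrad_shape_apply hp]

theorem tgrad_tgrad_meanCurv (h : IsOriented S N) (hp : p ∈ S) (u v : Amb n) :
    tgrad S (fun q => tgrad S (meanCurv S N) q v) p u =
      ∑ j, ⟪ddShape S N p u v (stdVec j), stdVec j⟫_ℝ := by
  rw [tgrad_congr hp fun q hq => h.tgrad_meanCurv hq v, tgrad_sum fun j _ =>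
    ((h.smoothOn_dShape_apply₂ _ _).inner (smoothOn_const _)).differentiableWithinAt hp]
  refine Finset.sum_congr rfl fun j _ => ?_
  rw [tgrad_inner_const ((h.smoothOn_dShape_apply₂ _ _).differentiableWithinAt hp),
    h.tgrad_dShape_apply hp]

theorem tgrad_sffNormSq (h : IsOriented S N) (hp : p ∈ S) (v : Amb n) :
    tgrad S (sffNormSq S N) p v =
      ∑ j, 2 * ⟪dShape S N p v (stdVec j), shape S N p (stdVec j)⟫_ℝ := by
  rw [tgrad_congr hp fun q hq => h.sffNormSq_eq_sum_stdVec hq, tgrad_sum fun j _ =>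
    ((h.smoothOn_shape_apply _).inner (h.smoothOn_shape_apply _)).differentiableWithinAt hp]
  refine Finset.sum_congr rfl fun j _ => ?_
  have hd := (h.smoothOn_shape_apply (stdVec j)).differentiableWithinAt hp
  rw [tgrad_inner hd hd, h.tgrad_shape_apply hp, real_inner_comm (shape S N p (stdVec j))]
  ring

theorem tgrad_tgrad_sffNormSq (h : IsOriented S N) (hp : p ∈ S) (u v : Amb n) :
    tgrad S (fun q => tgrad S (sffNormSq S N) q v) p u =
      ∑ j, 2 * (⟪ddShape S N p u v (stdVec j), shape S N p (stdVec j)⟫_ℝ +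
        ⟪dShape S N p v (stdVec j), dShape S N p u (stdVec j)⟫_ℝ) := by
  have hs : ∀ j : Fin (n + 1),
      SmoothOn S (fun q => ⟪dShape S N q v (stdVec j), shape S N q (stdVec j)⟫_ℝ) :=
    fun j => (h.smoothOn_dShape_apply₂ _ _).inner (h.smoothOn_shape_apply _)
  rw [tgrad_congr hp fun q hq => h.tgrad_sffNormSq hq v, tgrad_sum fun j _ =>
    ((smoothOn_const (2 : ℝ)).mul (hs j)).differentiableWithinAt hp]
  refine Finset.sum_congr rfl fun j _ => ?_
  rw [tgrad_mul (differentiableWithinAt_const _) ((hs j).differentiableWithinAt hp), tgrad_const,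
    tgrad_inner ((h.smoothOn_dShape_apply₂ _ _).differentiableWithinAt hp)
      ((h.smoothOn_shape_apply _).differentiableWithinAt hp), h.tgrad_dShape_apply hp,
    h.tgrad_shape_apply hp]
  ring

/-- Simons' identity, for the derivatives of `W = DN` in the ambient space. -/
theorem sum_inner_ddShape (h : IsOriented S N) (hp : p ∈ S) {u v : Amb n}
    (hu : u ∈ tangent S p) (hv : v ∈ tangent S p) :
    ∑ i, ⟪ddShape S N p (frameVec S p i) (frameVec S p i) u, v⟫_ℝ =
      tgrad S (fun q => tgrad S (meanCurv S N) q v) p u -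
        2 * ⟪shape S N p u, shape S N p (shape S N p v)⟫_ℝ +
        meanCurv S N p * ⟪shape S N p u, shape S N p v⟫_ℝ -
        sffNormSq S N p * ⟪shape S N p u, v⟫_ℝ := by
  -- Swap e with u by differentiated Codazzi, commute the two derivatives, move the endomorphism
  -- across by self-adjointness, then swap e with v. This leaves a summand of the trace of the
  -- second derivative of W in the directions u, v.
  have key : ∀ e ∈ tangent S p, ⟪ddShape S N p e e u, v⟫_ℝ =
      ⟪ddShape S N p u v e, e⟫_ℝ - ⟪shape S N p e, shape S N p e⟫_ℝ * ⟪shape S N p u, v⟫_ℝ +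
        ⟪shape S N p e, e⟫_ℝ * ⟪shape S N p u, shape S N p v⟫_ℝ := by
    intro e he
    have h1 := h.ddShape_sub hp (z := e) he hu
    have h2 := h.ddShape_sub hp (z := u) he hv
    rw [sub_eq_iff_eq_add] at h1 h2
    rw [h1, h.ddShape_comm hp he hu, inner_add_left, h.inner_ddShape_comm hp u e e v,
      real_inner_comm (ddShape S N p u e v) e, h2]
    simp only [inner_add_left, inner_sub_left, real_inner_smul_left]
    have a1 : ∀ x y, ⟪shape S N p (shape S N p x), y⟫_ℝ = ⟪shape S N p x, shape S N p y⟫_ℝ :=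
      fun x y => h.inner_shape_comm hp _ _
    rw [a1, a1, a1, a1, ← h.inner_shape_comm hp e u, ← h.inner_shape_comm hp u e,
      ← h.inner_shape_comm hp v u, ← h.inner_shape_comm hp e e,
      real_inner_comm (shape S N p e) (shape S N p v),
      h.inner_shape_comm hp v u, h.inner_shape_comm hp e u, real_inner_comm v (shape S N p u),
      real_inner_comm e (shape S N p u)]
    ring
  -- Hess H is the trace over the whole ambient space; the tangential trace lacks the (N, N) entry,
  -- which is the term 2⟨W u, W²v⟩.
  rw [Finset.sum_congr rfl fun i _ => key _ (frameVec_mem i), Finset.sum_add_distrib,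
    Finset.sum_sub_distrib, ← Finset.sum_mul, ← Finset.sum_mul, ← meanCurv_eq,
    ← h.sffNormSq_eq hp, h.tgrad_tgrad_meanCurv hp, h.sum_stdVec_inner_self hp,
    h.inner_ddShape_normal_normal hp]
  ring

/-- The two projection corrections in ∇²A sum over the frame to 2⟨W u, W²v⟩ and cancel the normal
entry in `sum_inner_ddShape`. -/
theorem laplacian_sff (h : IsOriented S N) (hp : p ∈ S) {u v : Amb n}
    (hu : u ∈ tangent S p) (hv : v ∈ tangent S p) :
    laplacian S (sff S N) p ![u, v] =
      -tgrad S (fun q => tgrad S (meanCurv S N) q v) p u -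
        meanCurv S N p * ⟪shape S N p u, shape S N p v⟫_ℝ +
        sffNormSq S N p * ⟪shape S N p u, v⟫_ℝ := by
  have h1 : ∀ i, nabla S (nabla S (sff S N)) p
      (Fin.cons (frameVec S p i) (Fin.cons (frameVec S p i) ![u, v])) =
      -(⟪ddShape S N p (frameVec S p i) (frameVec S p i) u, v⟫_ℝ +
        ⟪frameVec S p i, shape S N p u⟫_ℝ * ⟪frameVec S p i, shape S N p (shape S N p v)⟫_ℝ +
        ⟪frameVec S p i, shape S N p v⟫_ℝ * ⟪frameVec S p i, shape S N p (shape S N p u)⟫_ℝ) := by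
    intro i
    rw [h.nabla_nabla_sff_apply hp (frameVec_mem i) hu hv]
    show -(⟪ddShape S N p (frameVec S p i) (frameVec S p i) u, v⟫_ℝ +
      ⟪u, shape S N p (frameVec S p i)⟫_ℝ *
        ⟪shape S N p (shape S N p (frameVec S p i)), v⟫_ℝ +
      ⟪v, shape S N p (frameVec S p i)⟫_ℝ *
        ⟪shape S N p (shape S N p (frameVec S p i)), u⟫_ℝ) = _
    simp only [h.inner_shape_comm hp (shape S N p (frameVec S p i)),
      h.inner_shape_comm hp (frameVec S p i), ← h.inner_shape_comm hp u,
      ← h.inner_shape_comm hp v, real_inner_comm (frameVec S p i)]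
  show ∑ i, nabla S (nabla S (sff S N)) p
      (Fin.cons (frameVec S p i) (Fin.cons (frameVec S p i) ![u, v])) = _
  simp only [h1, Finset.sum_neg_distrib, Finset.sum_add_distrib]
  rw [h.sum_inner_ddShape hp hu hv, h.sum_frameVec_inner_mul_of_mem hp (h.shape_mem hp _),
    h.sum_frameVec_inner_mul_of_mem hp (h.shape_mem hp _),
    ← h.inner_shape_comm hp (shape S N p v), real_inner_comm (shape S N p u)]
  ring

end IsOriented

end LambdaHypersurface

/-! ### Using the λ-hypersurface equation. -/

namespace LambdaHypersurface

variable {n : ℕ} {S : Set (Amb n)} {N : Amb n → Amb n} {p : Amb n} {lam : ℝ}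

namespace IsLambdaHypersurface

theorem isOriented (hS : IsLambdaHypersurface lam S N) : IsOriented S N :=
  ⟨hS.smooth, hS.normal⟩

theorem meanCurv_eq (hS : IsLambdaHypersurface lam S N) (hp : p ∈ S) :
    meanCurv S N p = lam + (1 / 2 : ℝ) * ⟪p, N p⟫_ℝ := by
  linarith [hS.eqn p hp]

theorem tgrad_meanCurv (hS : IsLambdaHypersurface lam S N) (hp : p ∈ S) (v : Amb n) :
    tgrad S (meanCurv S N) p v = (1 / 2 : ℝ) * ⟪p, shape S N p v⟫_ℝ := by
  have h := hS.isOriented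
  have hx := smoothOn_of_contDiff (S := S) (contDiff_fun_id : ContDiff ℝ ∞ fun q : Amb n => q)
  have hi := hx.inner h.smoothOn_normal
  rw [tgrad_congr hp fun q hq => hS.meanCurv_eq hq,
    tgrad_add (differentiableWithinAt_const _)
      (((smoothOn_const _).mul hi).differentiableWithinAt hp),
    tgrad_mul (differentiableWithinAt_const _) (hi.differentiableWithinAt hp),
    tgrad_inner (hx.differentiableWithinAt hp) (h.smoothOn_normal.differentiableWithinAt hp),
    tgrad_const, tgrad_const, tgrad_id, h.inner_normal hp (proj_mem p v), shape]
  ring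

theorem tgrad_tgrad_meanCurv (hS : IsLambdaHypersurface lam S N) (hp : p ∈ S) {u : Amb n}
    (hu : u ∈ tangent S p) (v : Amb n) :
    tgrad S (fun q => tgrad S (meanCurv S N) q v) p u =
      (1 / 2 : ℝ) * (⟪shape S N p u, v⟫_ℝ + ⟪dShape S N p p u, v⟫_ℝ -
        ⟪p, N p⟫_ℝ * ⟪shape S N p u, shape S N p v⟫_ℝ) := by
  have h := hS.isOriented
  have hx := smoothOn_of_contDiff (S := S) (contDiff_fun_id : ContDiff ℝ ∞ fun q : Amb n => q)
  have hi := hx.inner (h.smoothOn_shape_apply v)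
  -- Split x into xᵀ and its normal part. Codazzi exchanges u and xᵀ, producing the drift term; the
  -- normal part contributes through (D_u W)N = -W²u.
  have h1 : ⟪p, dShape S N p u v⟫_ℝ = ⟪dShape S N p p u, v⟫_ℝ -
      ⟪p, N p⟫_ℝ * ⟪shape S N p u, shape S N p v⟫_ℝ := by
    have h2 : p = proj S p p + ⟪p, N p⟫_ℝ • N p := by rw [h.proj_apply hp]; simp
    have h3 := congrArg (fun x => ⟪dShape S N p u x, v⟫_ℝ) h2
    simp only [map_add, map_smul, inner_add_left, real_inner_smul_left, h.dShape_normal hp,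
      inner_neg_left, h.dShape_comm hp hu (proj_mem p p)] at h3
    rw [IsOriented.dShape_proj, h.inner_shape_comm hp (shape S N p u) v] at h3
    rw [← h.inner_dShape_comm hp, h3]
    ring
  rw [tgrad_congr hp fun q hq => hS.tgrad_meanCurv hq v,
    tgrad_mul (differentiableWithinAt_const _) (hi.differentiableWithinAt hp),
    tgrad_inner (hx.differentiableWithinAt hp)
      ((h.smoothOn_shape_apply v).differentiableWithinAt hp),
    tgrad_const, tgrad_id, h.tgrad_shape_apply hp, proj_eq_self hu, h1,
    ← h.inner_shape_comm hp u v]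
  ring

theorem stabOp_sff (hS : IsLambdaHypersurface lam S N) (hp : p ∈ S) {u v : Amb n}
    (hu : u ∈ tangent S p) (hv : v ∈ tangent S p) :
    stabOp S N (sff S N) p ![u, v] = sff S N p ![u, v] - lam * sffSq S N p ![u, v] := by
  have h := hS.isOriented
  rw [stabOp, h.laplacian_sff hp hu hv, h.nablaPos_sff hp, h.sff_apply hp (v := ![u, v]) hu,
    h.sffSq_eq hp (v := ![u, v]) hu, hS.tgrad_tgrad_meanCurv hp hu, hS.meanCurv_eq hp]
  simp only [Matrix.cons_val_zero, Matrix.cons_val_one]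
  ring

theorem stabOp_meanCurv (hS : IsLambdaHypersurface lam S N) (hp : p ∈ S) (v : Fin 0 → Amb n) :
    stabOp S N (scalar (meanCurv S N)) p v = meanCurv S N p + lam * sffNormSq S N p := by
  have h := hS.isOriented
  -- The (N, N) entry of the derivative of W is zero because W N = 0, so here the tangential trace
  -- equals the full one.
  have h1 : tgrad S (meanCurv S N) p p =
      ∑ i, ⟪dShape S N p p (frameVec S p i), frameVec S p i⟫_ℝ := by
    rw [h.tgrad_meanCurv hp, h.sum_stdVec_inner_self hp, h.inner_dShape_normal hp,
      h.shape_normal hp]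
    simp
  rw [stabOp, laplacian_scalar, nablaPos_scalar,
    Finset.sum_congr rfl fun i _ => hS.tgrad_tgrad_meanCurv hp (frameVec_mem i) _,
    ← Finset.mul_sum, Finset.sum_sub_distrib, Finset.sum_add_distrib, ← Finset.mul_sum,
    ← h1, ← IsOriented.meanCurv_eq, ← h.sffNormSq_eq hp]
  simp only [scalar]
  linear_combination sffNormSq S N p * hS.meanCurv_eq hp

theorem driftLap_sffNormSq (hS : IsLambdaHypersurface lam S N) (hp : p ∈ S)
    (v : Fin 0 → Amb n) :
    driftLap S (scalar (sffNormSq S N)) p v =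
      2 * (1 / 2 - sffNormSq S N p) * sffNormSq S N p
        - 2 * lam * tensorInner S (sffSq S N) (sff S N) p
        + 2 * tensorInner S (nabla S (sff S N)) (nabla S (sff S N)) p := by
  have h := hS.isOriented
  set e := frameVec S p
  have hW : ∀ x : Amb n, ⟪x, shape S N p (N p)⟫_ℝ = 0 := fun x => by
    rw [h.shape_normal hp, inner_zero_right]
  have hpos : tgrad S (sffNormSq S N) p p =
      2 * ∑ k, ⟪dShape S N p p (e k), shape S N p (e k)⟫_ℝ := by
    rw [h.tgrad_sffNormSq hp, ← Finset.mul_sum, h.sum_stdVec_inner hp, hW, add_zero]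
  have hσ : sffNormSq S N p = ∑ k, ⟪shape S N p (e k), shape S N p (e k)⟫_ℝ := h.sffNormSq_eq hp
  -- Simons' identity with u = eₖ and v = W eₖ. The coefficient of the cubic trace is H - ½⟨x, N⟩ =
  -- λ, and the quartic term -2Σ|W²eₖ|² cancels the one in `hgrad`.
  have hdd : ∑ i, ∑ j, ⟪ddShape S N p (e i) (e i) (stdVec j), shape S N p (stdVec j)⟫_ℝ =
      (1 / 2 : ℝ) * ∑ k, ⟪shape S N p (e k), shape S N p (e k)⟫_ℝ +
        (1 / 2 : ℝ) * ∑ k, ⟪dShape S N p p (e k), shape S N p (e k)⟫_ℝ +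
        lam * ∑ k, ⟪shape S N p (shape S N p (e k)), shape S N p (e k)⟫_ℝ -
        2 * ∑ k, ⟪shape S N p (shape S N p (e k)), shape S N p (shape S N p (e k))⟫_ℝ -
        sffNormSq S N p * ∑ k, ⟪shape S N p (e k), shape S N p (e k)⟫_ℝ := by
    simp only [h.sum_stdVec_inner hp, hW, add_zero]
    rw [Finset.sum_comm, Finset.sum_congr rfl fun k _ =>
      h.sum_inner_ddShape hp (frameVec_mem k) (h.shape_mem hp _)]
    simp only [Finset.mul_sum, ← Finset.sum_add_distrib, ← Finset.sum_sub_distrib]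
    refine Finset.sum_congr rfl fun k _ => ?_
    have hk : frameVec S p k = e k := rfl
    rw [hS.tgrad_tgrad_meanCurv hp (frameVec_mem k), hS.meanCurv_eq hp, hk,
      h.inner_shape_comm hp (shape S N p (e k)) (shape S N p (e k)),
      h.inner_shape_comm hp (shape S N p (e k)) (shape S N p (shape S N p (e k)))]
    ring
  have hgrad : ∑ i, ∑ j, ⟪dShape S N p (e i) (stdVec j), dShape S N p (e i) (stdVec j)⟫_ℝ =
      tensorInner S (nabla S (sff S N)) (nabla S (sff S N)) p +
        2 * ∑ k, ⟪shape S N p (shape S N p (e k)), shape S N p (shape S N p (e k))⟫_ℝ := by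
    rw [h.tensorInner_nabla_sff hp, Finset.mul_sum, ← Finset.sum_add_distrib]
    exact Finset.sum_congr rfl fun i _ => h.sum_stdVec_dShape hp
  have hlap : laplacian S (scalar (sffNormSq S N)) p v =
      2 * ((∑ i, ∑ j, ⟪ddShape S N p (e i) (e i) (stdVec j), shape S N p (stdVec j)⟫_ℝ) +
        ∑ i, ∑ j, ⟪dShape S N p (e i) (stdVec j), dShape S N p (e i) (stdVec j)⟫_ℝ) := by
    rw [laplacian_scalar]
    simp only [h.tgrad_tgrad_sffNormSq hp, ← Finset.mul_sum, Finset.sum_add_distrib]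
    rfl
  rw [driftLap, nablaPos_scalar, hlap, hdd, ← hσ, hgrad, hpos, h.tensorInner_sffSq_sff hp]
  ring

end IsLambdaHypersurface

end LambdaHypersurface

open LambdaHypersurface in
theorem lemma2p10 (n : ℕ) (lam : ℝ) (S : Set (Amb n)) (N : Amb n → Amb n)
    (hS : IsLambdaHypersurface lam S N) :
    (∀ p ∈ S, ∀ u ∈ tangent S p, ∀ v ∈ tangent S p,
      stabOp S N (sff S N) p ![u, v] = sff S N p ![u, v] - lam * sffSq S N p ![u, v]) ∧
    (∀ p ∈ S, stabOp S N (scalar (meanCurv S N)) p ![] =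
      meanCurv S N p + lam * sffNormSq S N p) ∧
    (∀ p ∈ S, driftLap S (scalar (sffNormSq S N)) p ![] =
      2 * (1 / 2 - sffNormSq S N p) * sffNormSq S N p
        - 2 * lam * tensorInner S (sffSq S N) (sff S N) p
        + 2 * tensorInner S (nabla S (sff S N)) (nabla S (sff S N)) p) :=
  ⟨fun _ hp _ hu _ hv => hS.stabOp_sff hp hu hv, fun _ hp => hS.stabOp_meanCurv hp _,
    fun _ hp => hS.driftLap_sffNormSq hp _⟩
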